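/- Let $0\le d_1<d_2$ be integers with $d_2-d_1$ odd. For $d\ge 0$ let $V_d$ be the space of complex binary forms of degree $d$ with the natural action of $SL_2(\mathbb C)$, let $\mathcal I_{d_1,d_2}=\mathcal O(V_{d_1}\oplus V_{d_2})^{SL_2}$ be the graded algebra of joint invariants, and let $\mathcal{PI}_{d_1,d_2}(z)=\sum_{n\ge 0}\dim\big((\mathcal I_{d_1,d_2})_n\big)z^n$ be its Poincaré series. Put $(a,q)_n=(1-a)(1-aq)\cdots(1-aq^{n-1})$, put $\varphi_n\big(\sum_{i\ge0} a_iz^i\big)=\sum_{i\ge0}a_{in}z^i$ for formal power series and $n\ge 0$, and put $$f_{d_1,d_2}(t,z)=\frac{1}{\prod_{i=0}^{d_1}(1-tz^{d_1-2i})\ \prod_{i=0}^{d_2}(1-tz^{d_2-2i})}.$$ For $0\le k\le d_1$ let $$A_k(z)=\frac{(-1)^k z^{(d_1-k)(d_1-k+1)+(d_2+1)(d_1-2k)}}{(z^2,z^2)_k\,(z^2,z^2)_{d_1-k}\,(z^{d_1-d_2-2k},z^2)_{d_2+1}},$$ and for $0\le k\le d_2/2$ let $$B_k(z)=\begin{cases}\dfrac{(-1)^k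 z^{k(k+1)}}{(z^{d_2-d_1-2k},z^2)_{d_1+1}\,(z^2,z^2)_k\,(z^2,z^2)_{d_2-k}} & \text{if } 2k<d_2-d_1,\\[3ex] \dfrac{(-1)^{\frac{d_2-d_1-1}{2}}\, z^{k(k+1)+(s+1)^2}}{(z,z^2)_{s+1}\,(z,z^2)_{d_1-s}\,(z^2,z^2)_k\,(z^2,z^2)_{d_2-k}} & \text{if } 2k=d_2-d_1+2s+1,\ s\ge 0.\end{cases}$$ Then these are coefficients of the partial fraction decomposition of $f_{d_1,d_2}(tz^{d_2},z)$ with respect to $t$: there are rational functions $B_k(z)$ also for $d_2/2<k\le d_2$ such that $$f_{d_1,d_2}(tz^{d_2},z)=\sum_{k=0}^{d_1}\frac{A_k(z)}{1-tz^{d_2+d_1-2k}}+\sum_{k=0}^{d_2}\frac{B_k(z)}{1-tz^{2k}}.$$ Moreover, the functions $(1-z^2)A_k(z)$ for $d_1/2\le k\le d_1$ and $(1-z^2)B_k(z)$ for $0\le k\le d_2/2$ are regular at $z=0$, and, identifying them with their power series expansions at $0$, $$\mathcal{PI}_{d_1,d_2}(z)=\sum_{d_1/2\le k\le d_1}\varphi_{2k-d_1}\big((1-z^2)A_k(z)\big)+\sum_{k=0}^{\lfloor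 d_2/2\rfloor}\varphi_{d_2-2k}\big((1-z^2)B_k(z)\big).$$ -/

import Mathlib

noncomputable section

namespace BinaryForms

/-- The binary form `∑ i, c i * x ^ (d - i) * y ^ i` of degree `d` with coefficient vector `c`. -/
def form (d : ℕ) (c : Fin (d + 1) → ℂ) : MvPolynomial (Fin 2) ℂ :=
  ∑ i : Fin (d + 1),
    MvPolynomial.C (c i) * MvPolynomial.X 0 ^ (d - (i : ℕ)) * MvPolynomial.X 1 ^ (i : ℕ)

/-- The linear substitution `x ↦ g₀₀ x + g₀₁ y`, `y ↦ g₁₀ x + g₁₁ y` in a polynomial. -/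
def subst (g : Matrix.SpecialLinearGroup (Fin 2) ℂ) :
    MvPolynomial (Fin 2) ℂ →ₐ[ℂ] MvPolynomial (Fin 2) ℂ :=
  MvPolynomial.aeval fun i => ∑ j : Fin 2, MvPolynomial.C (g.1 i j) * MvPolynomial.X j

/-- The action of `g ∈ SL₂(ℂ)` by linear substitution, on coefficient vectors of binary forms of
degree `d`: the `i`-th entry is the coefficient of `x ^ (d - i) * y ^ i` in the transformed
form. -/
def act (d : ℕ) (g : Matrix.SpecialLinearGroup (Fin 2) ℂ) (c : Fin (d + 1) → ℂ) :
    Fin (d + 1) → ℂ :=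
  fun i => MvPolynomial.coeff
    (Finsupp.single 0 (d - (i : ℕ)) + Finsupp.single 1 (i : ℕ)) (subst g (form d c))

/-- The algebra of joint invariants of two binary forms of degrees `d₁` and `d₂`: the polynomial
functions on `V_{d₁} ⊕ V_{d₂}`, written in the coefficients of the two forms, that are constant
on the orbits of `SL₂(ℂ)`. -/
def jointInvariants (d₁ d₂ : ℕ) :
    Subalgebra ℂ (MvPolynomial (Fin (d₁ + 1) ⊕ Fin (d₂ + 1)) ℂ) where
  carrier := {F | ∀ (g : Matrix.SpecialLinearGroup (Fin 2) ℂ)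
    (p : Fin (d₁ + 1) → ℂ) (q : Fin (d₂ + 1) → ℂ),
    MvPolynomial.eval (Sum.elim (act d₁ g p) (act d₂ g q)) F =
      MvPolynomial.eval (Sum.elim p q) F}
  mul_mem' := by
    intro F G hF hG g p q
    rw [map_mul, map_mul, hF g p q, hG g p q]
  add_mem' := by
    intro F G hF hG g p q
    rw [map_add, map_add, hF g p q, hG g p q]
  algebraMap_mem' := by
    intro r g p q
    simp [MvPolynomial.algebraMap_eq]

/-- The space of joint invariants that are homogeneous of degree `n`. -/
def jointInvariantsOfDegree (d₁ d₂ n : ℕ) :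
    Submodule ℂ (MvPolynomial (Fin (d₁ + 1) ⊕ Fin (d₂ + 1)) ℂ) :=
  Subalgebra.toSubmodule (jointInvariants d₁ d₂) ⊓ MvPolynomial.homogeneousSubmodule _ ℂ n

/-- The Poincaré series of the algebra of joint invariants. -/
def poincareSeries (d₁ d₂ : ℕ) : PowerSeries ℂ :=
  PowerSeries.mk fun n => (Module.finrank ℂ (jointInvariantsOfDegree d₁ d₂ n) : ℂ)

/-- The map `∑ aᵢ zⁱ ↦ ∑ a_{i n} zⁱ` on formal power series. -/
def phi (n : ℕ) (R : PowerSeries ℂ) : PowerSeries ℂ :=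
  PowerSeries.mk fun i => PowerSeries.coeff (i * n) R

/-- `(a, q)_n = (1 - a) (1 - a q) ⋯ (1 - a q ^ (n - 1))`. -/
def qPoch {K : Type*} [Field K] (a q : K) (n : ℕ) : K :=
  ∏ i ∈ Finset.range n, (1 - a * q ^ i)

/-- The generating function
`1 / ((1 - t z^{d₁}) (1 - t z^{d₁-2}) ⋯ (1 - t z^{-d₁})
  (1 - t z^{d₂}) (1 - t z^{d₂-2}) ⋯ (1 - t z^{-d₂}))`. -/
def genFun {K : Type*} [Field K] (d₁ d₂ : ℕ) (t z : K) : K :=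
  1 / ((∏ i ∈ Finset.range (d₁ + 1), (1 - t * z ^ ((d₁ : ℤ) - 2 * (i : ℤ)))) *
    ∏ i ∈ Finset.range (d₂ + 1), (1 - t * z ^ ((d₂ : ℤ) - 2 * (i : ℤ))))

open RatFunc in
/-- The rational function `A_k(z)` (for `k ≤ d₁`). -/
def coeffA (d₁ d₂ k : ℕ) : RatFunc ℂ :=
  (-1) ^ k *
      X ^ (((d₁ : ℤ) - k) * ((d₁ : ℤ) - k + 1) + ((d₂ : ℤ) + 1) * ((d₁ : ℤ) - 2 * k)) /
    (qPoch (X ^ 2) (X ^ 2) k * qPoch (X ^ 2) (X ^ 2) (d₁ - k) *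
      qPoch (X ^ ((d₁ : ℤ) - d₂ - 2 * k)) (X ^ 2) (d₂ + 1))

open RatFunc in
/-- The rational function `B_k(z)` (for `2 k ≤ d₂`), where `d₁ < d₂` and `d₂ - d₁` is odd. In the
second case `2 k > d₂ - d₁`, and `s` is given by `2 k = d₂ - d₁ + 2 s + 1`. -/
def coeffB (d₁ d₂ k : ℕ) : RatFunc ℂ :=
  if 2 * k < d₂ - d₁ then
    (-1) ^ k * X ^ (k * (k + 1)) /
      (qPoch (X ^ ((d₂ : ℤ) - d₁ - 2 * k)) (X ^ 2) (d₁ + 1) *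
        qPoch (X ^ 2) (X ^ 2) k * qPoch (X ^ 2) (X ^ 2) (d₂ - k))
  else
    let s : ℕ := (2 * k - (d₂ - d₁) - 1) / 2
    (-1) ^ ((d₂ - d₁ - 1) / 2) * X ^ (k * (k + 1) + (s + 1) ^ 2) /
      (qPoch X (X ^ 2) (s + 1) * qPoch X (X ^ 2) (d₁ - s) *
        qPoch (X ^ 2) (X ^ 2) k * qPoch (X ^ 2) (X ^ 2) (d₂ - k))

/-- `A 0, …, A d₁` and `B 0, …, B d₂` are the coefficients of the partial fraction decomposition
`f(t z^{d₂}, z) = ∑_{k ≤ d₁} A_k(z) / (1 - t z^{d₂+d₁-2k}) + ∑_{k ≤ d₂} B_k(z) / (1 - t z^{2k})`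
in `ℂ(z)(t)`, where `f` is the generating function above. -/
def IsPartialFractionDecomposition (d₁ d₂ : ℕ) (A B : ℕ → RatFunc ℂ) : Prop :=
  let t : RatFunc (RatFunc ℂ) := RatFunc.X
  let z : RatFunc (RatFunc ℂ) := RatFunc.C RatFunc.X
  genFun d₁ d₂ (t * z ^ d₂) z =
    ∑ k ∈ Finset.range (d₁ + 1),
        RatFunc.C (A k) / (1 - t * z ^ ((d₂ : ℤ) + d₁ - 2 * k)) +
      ∑ k ∈ Finset.range (d₂ + 1), RatFunc.C (B k) / (1 - t * z ^ (2 * k))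

/-- The rational function `R` is regular at `0`, and `r` is its Taylor expansion there (equality
is that of Laurent series). -/
def IsExpansion (R : RatFunc ℂ) (r : PowerSeries ℂ) : Prop :=
  (R : LaurentSeries ℂ) = (r : LaurentSeries ℂ)

end BinaryForms

end

/-!
The dimension of the space of joint invariants of degree `n` is given by the Cayley–Sylvester
formula: it is the number of monomials of degree `n` and torus weight `0` minus the number of those
of weight `-2` (`finrank_jointInvariantsOfDegree_add`). To obtain it, invariance under the upper and
the lower unitriangular matrices, which generate `SL₂(ℂ)`, is translated into being killed by a
raising derivation `D` and a lowering derivation `E` (`mem_jointInvariants_iff`): along the curve of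
a one-parameter group a polynomial function is a polynomial in the parameter, whose derivative is
the value of the derivation. The commutator `[D, E]` acts by the weight, so that in degree `n` the
maps `D` and `E` satisfy the relations of `sl₂`. With bounded weights this forces `E` to map
weight `0` onto weight `-2`, and its kernel in weight `0` to be killed by `D` as well
(`finrank_ker_lower_add`, `raise_eq_zero_of_lower_eq_zero`).

Hence the dimension is the coefficient of `t ^ n * z ^ (n * d₂)` in `(1 - z ^ 2) * f (t z ^ d₂, z)`,
where `f (t z ^ d₂, z) = 1 / ∏ i, (1 - t z ^ e i)` with distinct exponents `e i ≥ 0`; they are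
distinct since `d₂ - d₁` is odd. By Lagrange interpolation at the nodes `z ^ (-e i)`, the partial
fraction coefficients are `R i = ∏ j ≠ i, 1 / (1 - z ^ (e j - e i))` (`residue`). Every factor is
regular at `z = 0`, and so is `R i`; a factor with `e j < e i` vanishes there. The coefficient of
`t ^ n` is therefore `∑ i, (1 - z ^ 2) * R i * z ^ (n * e i)`, and the coefficient of
`z ^ (n * d₂)` in it picks the coefficient of `z ^ (n * (d₂ - e i))` in `(1 - z ^ 2) * R i`, which is
what `phi (d₂ - e i)` extracts. The terms with `e i > d₂` contribute nothing
(`card_filter_sub_card_filter`). Rewriting the factors with negative exponents identifies the `R i`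
with the functions `coeffA` and `coeffB` (`residue_inl`, `residue_inr_eq_coeffB`).
-/

/-! ### Representations of `sl₂` with bounded weights -/

section WeightSpaces

variable {V : Type*} [AddCommGroup V] [Module ℂ V] {u d : V →ₗ[ℂ] V} {W : ℤ → Submodule ℂ V}

/-- If `u` raises weights by `2` and `[u, d]` acts as the weight, then `u ∘ d` is injective on
the space of weight `2`: a vector `v` with `u (d v) = 0` satisfies
`d (u ^ (m + 1) v) = -(m + 1) (m + 2) u ^ m v`, so none of the vectors `u ^ m v` would vanish. -/
theorem eq_zero_of_raise_lower_eq_zero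
    (hu : ∀ w, ∀ v ∈ W w, u v ∈ W (w + 2))
    (hud : ∀ w, ∀ v ∈ W w, u (d v) - d (u v) = (w : ℂ) • v)
    {N : ℤ} (hN : ∀ w, N < w → W w = ⊥) {v : V} (hv : v ∈ W 2) (h0 : u (d v) = 0) : v = 0 := by
  have hmem : ∀ m : ℕ, (u ^ m) v ∈ W (2 + 2 * m) := by
    intro m
    induction m with
    | zero => simpa using hv
    | succ m ih =>
      rw [pow_succ', Module.End.mul_apply]
      convert! hu _ _ ih using 2
  have hchain : ∀ m : ℕ, d ((u ^ (m + 1)) v) = -(((m : ℂ) + 1) * (m + 2)) • (u ^ m) v := by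
    intro m
    induction m with
    | zero =>
      have h := hud 2 v hv
      rw [h0, zero_sub, neg_eq_iff_eq_neg] at h
      simp [h]
    | succ m ih =>
      have h := hud _ _ (hmem (m + 1))
      rw [ih, map_smul, ← Module.End.mul_apply u, ← pow_succ', ← Module.End.mul_apply u,
        ← pow_succ', sub_eq_iff_eq_add', ← sub_eq_iff_eq_add] at h
      rw [← h, ← sub_smul]
      congr 1
      push_cast; ring
  have hdesc : ∀ m : ℕ, (u ^ m) v = 0 → v = 0 := by
    intro m
    induction m with
    | zero => simp
    | succ m ih =>
      intro h
      have h2 := hchain m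
      rw [h, map_zero] at h2
      refine ih ((smul_eq_zero.mp h2.symm).resolve_left ?_)
      refine neg_ne_zero.mpr ?_
      exact_mod_cast (by positivity : (m + 1) * (m + 2) ≠ 0)
  refine hdesc N.toNat ?_
  have h := hmem N.toNat
  rwa [hN _ (by have := Int.self_le_toNat N; omega), Submodule.mem_bot] at h

variable (hu : ∀ w, ∀ v ∈ W w, u v ∈ W (w + 2)) (hd : ∀ w, ∀ v ∈ W w, d v ∈ W (w - 2))
    (hud : ∀ w, ∀ v ∈ W w, u (d v) - d (u v) = (w : ℂ) • v)
    {N : ℤ} (hN : ∀ w, N < |w| → W w = ⊥)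

include hu hud hN in
/-- A vector of weight zero that is killed by the lowering operator is killed by the raising
operator. -/
theorem raise_eq_zero_of_lower_eq_zero {v : V} (hv : v ∈ W 0) (h0 : d v = 0) : u v = 0 := by
  refine eq_zero_of_raise_lower_eq_zero hu hud (N := N)
    (fun w hw => hN w (hw.trans_le (le_abs_self w))) (hu 0 v hv) ?_
  have h := hud 0 v hv
  rw [h0, map_zero, zero_sub] at h
  simp_all

include hu hd hud hN in
/-- The lowering operator maps the space of weight `0` onto the space of weight `-2`; hence the
dimension of its kernel is the difference of their dimensions. -/
theorem finrank_ker_lower_add [FiniteDimensional ℂ (W 0)] [FiniteDimensional ℂ (W (-2))] :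
    Module.finrank ℂ (W 0 ⊓ LinearMap.ker d : Submodule ℂ V) + Module.finrank ℂ (W (-2)) =
      Module.finrank ℂ (W 0) := by
  let δ : W 0 →ₗ[ℂ] W (-2) := d.restrict (fun v hv => by simpa using hd 0 v hv)
  let υ : W (-2) →ₗ[ℂ] W 0 := u.restrict (fun v hv => by simpa using hu (-2) v hv)
  have hinj : Function.Injective (δ ∘ₗ υ) := by
    rw [← LinearMap.ker_eq_bot, LinearMap.ker_eq_bot']
    rintro ⟨v, hv⟩ h
    have h' : d (u v) = 0 := congrArg Subtype.val h
    have : v = 0 := by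
      -- exchanging the roles of `u` and `d` and negating the weights
      refine eq_zero_of_raise_lower_eq_zero (u := d) (d := u) (W := fun w => W (-w)) (N := N)
        ?_ ?_ (fun w hw => hN _ (by rw [abs_neg]; exact hw.trans_le (le_abs_self w))) hv h'
      · intro w v hv
        convert! hd _ v hv using 2
        ring
      · intro w v hv
        rw [← neg_sub, hud _ v hv]
        simp
    simpa using this
  have hsurj : Function.Surjective δ :=
    Function.Surjective.of_comp (g := υ) ((LinearMap.injective_iff_surjective).mp hinj)
  have hrn := LinearMap.finrank_range_add_finrank_ker δ
  rw [LinearMap.range_eq_top.mpr hsurj, finrank_top] at hrn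
  have hker : Module.finrank ℂ (LinearMap.ker δ) =
      Module.finrank ℂ (W 0 ⊓ LinearMap.ker d : Submodule ℂ V) := by
    have : (W 0 ⊓ LinearMap.ker d : Submodule ℂ V) = (LinearMap.ker δ).map (W 0).subtype := by
      ext v
      simp only [Submodule.mem_inf, LinearMap.mem_ker, Submodule.mem_map, Submodule.subtype_apply,
        Subtype.exists, exists_and_right, exists_eq_right]
      constructor
      · rintro ⟨hv, h⟩
        exact ⟨hv, Subtype.ext h⟩
      · rintro ⟨hv, h⟩
        exact ⟨hv, congrArg Subtype.val h⟩
    rw [this]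
    exact (LinearEquiv.finrank_eq
      (Submodule.equivMapOfInjective _ (W 0).injective_subtype _))
  omega

end WeightSpaces

/-! ### Invariance under one-parameter groups and derivations -/

section Flow

open MvPolynomial

variable {σ : Type*} (D : Derivation ℂ (MvPolynomial σ ℂ) (MvPolynomial σ ℂ))

/-- If polynomial curves `γ c : σ → ℂ[s]` start at `c` and are integral curves of the vector field
of `D`, then the functions that are constant along all these curves are those killed by `D`. -/
theorem forall_eval_curve_iff (γ : (σ → ℂ) → σ → Polynomial ℂ)
    (hγ0 : ∀ c i, (γ c i).eval 0 = c i)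
    (hγ : ∀ c i, Polynomial.derivative (γ c i) = aeval (γ c) (D (X i)))
    (F : MvPolynomial σ ℂ) :
    (∀ (s : ℂ) (c : σ → ℂ), eval (fun i => (γ c i).eval s) F = eval c F) ↔ D F = 0 := by
  have hev : ∀ c s (G : MvPolynomial σ ℂ),
      (aeval (γ c) G).eval s = eval (fun i => (γ c i).eval s) G := by
    intro c s G
    induction G using MvPolynomial.induction_on with
    | C a => simp
    | add p q hp hq => simp [hp, hq]
    | mul_X p i hp => simp [hp]
  have hder : ∀ c (G : MvPolynomial σ ℂ),
      Polynomial.derivative (aeval (γ c) G) = aeval (γ c) (D G) := by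
    intro c G
    induction G using MvPolynomial.induction_on with
    | C a => simp [MvPolynomial.derivation_C]
    | add p q hp hq => simp [hp, hq]
    | mul_X p i hp =>
      rw [map_mul, Polynomial.derivative_mul, hp, aeval_X, hγ, Derivation.leibniz]
      simp only [smul_eq_mul, map_add, map_mul, aeval_X]
      ring
  constructor
  · intro h
    refine MvPolynomial.funext fun c => ?_
    have hconst : aeval (γ c) F = Polynomial.C (eval c F) :=
      Polynomial.funext fun s => by rw [hev, h, Polynomial.eval_C]
    have h2 := hev c 0 (D F)
    rw [← hder, hconst, Polynomial.derivative_C] at h2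
    simpa [hγ0] using h2.symm
  · intro h s c
    have h2 := Polynomial.eq_C_of_derivative_eq_zero
      (p := aeval (γ c) F) (by rw [hder, h, map_zero])
    have h3 : (aeval (γ c) F).eval s = (aeval (γ c) F).eval 0 := by
      rw [h2, Polynomial.eval_C, Polynomial.eval_C]
    rw [hev, hev] at h3
    simpa [hγ0] using h3

end Flow

/-! ### The action of `SL₂` on binary forms -/

namespace BinaryForms

open MvPolynomial

theorem coeff_form (d : ℕ) (c : Fin (d + 1) → ℂ) (m : Fin 2 →₀ ℕ) :
    coeff m (form d c) =
      if h : m 0 + m 1 = d then c ⟨m 1, by omega⟩ else 0 := by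
  have hmono : ∀ i : Fin (d + 1), (C (c i) * X 0 ^ (d - (i : ℕ)) * X 1 ^ (i : ℕ) :
      MvPolynomial (Fin 2) ℂ) =
        monomial (Finsupp.single 0 (d - (i : ℕ)) + Finsupp.single 1 (i : ℕ)) (c i) := by
    intro i
    rw [X_pow_eq_monomial, X_pow_eq_monomial, mul_assoc, monomial_mul, C_mul_monomial]
    simp
  have hiff : ∀ i : Fin (d + 1),
      (Finsupp.single 0 (d - (i : ℕ)) + Finsupp.single 1 (i : ℕ) = m) ↔
        d - (i : ℕ) = m 0 ∧ (i : ℕ) = m 1 := by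
    intro i
    rw [Finsupp.ext_iff]
    simp [Fin.forall_fin_two]
  simp only [form, coeff_sum, hmono, coeff_monomial, hiff]
  split_ifs with h
  · rw [Finset.sum_eq_single (⟨m 1, by omega⟩ : Fin (d + 1))]
    · rw [if_pos]
      simp only [and_true]
      omega
    · intro i _ hi
      rw [if_neg]
      rintro ⟨-, h2⟩
      exact hi (Fin.ext h2)
    · simp
  · refine Finset.sum_eq_zero fun i _ => if_neg ?_
    rintro ⟨h1, h2⟩
    have := i.2
    omega

theorem isHomogeneous_form (d : ℕ) (c : Fin (d + 1) → ℂ) : (form d c).IsHomogeneous d := by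
  intro m hm
  rw [coeff_form] at hm
  split_ifs at hm with h
  · rw [← h, Finsupp.weight_apply, Finsupp.sum_fintype _ _ (by simp)]
    simp
  · exact absurd rfl hm

/-- The coefficient vector of a binary form of degree `d`. -/
noncomputable def formCoeff (d : ℕ) (P : MvPolynomial (Fin 2) ℂ) : Fin (d + 1) → ℂ :=
  fun i => coeff (Finsupp.single 0 (d - (i : ℕ)) + Finsupp.single 1 (i : ℕ)) P

theorem formCoeff_form (d : ℕ) (c : Fin (d + 1) → ℂ) : formCoeff d (form d c) = c := by
  funext i
  have := i.2
  rw [formCoeff, coeff_form, dif_pos]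
  · congr 1
    simp
  · simp
    omega

theorem form_formCoeff {d : ℕ} {P : MvPolynomial (Fin 2) ℂ} (hP : P.IsHomogeneous d) :
    form d (formCoeff d P) = P := by
  ext m
  rw [coeff_form]
  split_ifs with h
  · rw [formCoeff]
    congr 1
    ext j
    fin_cases j
    · simp
      omega
    · simp
  · by_contra hne
    have h2 := hP (Ne.symm hne)
    rw [Finsupp.weight_apply, Finsupp.sum_fintype _ _ (by simp)] at h2
    simp at h2
    exact h h2

theorem isHomogeneous_subst (g : Matrix.SpecialLinearGroup (Fin 2) ℂ)
    {P : MvPolynomial (Fin 2) ℂ} {d : ℕ} (hP : P.IsHomogeneous d) :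
    (subst g P).IsHomogeneous d := by
  have h := hP.aeval (fun i => ∑ j : Fin 2, C (g.1 i j) * X j) (n := 1)
    (fun i => IsHomogeneous.sum _ _ _ fun j _ => by
      simpa using (isHomogeneous_C (Fin 2) (g.1 i j)).mul (isHomogeneous_X ℂ j))
  simpa [subst] using h

theorem form_act (d : ℕ) (g : Matrix.SpecialLinearGroup (Fin 2) ℂ) (c : Fin (d + 1) → ℂ) :
    form d (act d g c) = subst g (form d c) :=
  form_formCoeff (isHomogeneous_subst g (isHomogeneous_form d c))

theorem subst_mul (g h : Matrix.SpecialLinearGroup (Fin 2) ℂ) (P : MvPolynomial (Fin 2) ℂ) :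
    subst (g * h) P = subst h (subst g P) := by
  have : subst (g * h) = (subst h).comp (subst g) := by
    ext1 i
    simp only [subst, aeval_X, AlgHom.comp_apply, map_mul, algHom_C, algebraMap_eq,
      Fin.sum_univ_two, Matrix.SpecialLinearGroup.coe_mul, Matrix.mul_apply, map_add]
    ring
  rw [this, AlgHom.comp_apply]

theorem act_mul (d : ℕ) (g h : Matrix.SpecialLinearGroup (Fin 2) ℂ) (c : Fin (d + 1) → ℂ) :
    act d (g * h) c = act d h (act d g c) := by
  rw [← formCoeff_form d (act d (g * h) c), ← formCoeff_form d (act d h _), form_act, form_act,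
    form_act, subst_mul]

/-- The upper unitriangular matrix with entry `s`. -/
def upper (s : ℂ) : Matrix.SpecialLinearGroup (Fin 2) ℂ :=
  ⟨!![1, s; 0, 1], by simp [Matrix.det_fin_two]⟩

/-- The lower unitriangular matrix with entry `s`. -/
def lower (s : ℂ) : Matrix.SpecialLinearGroup (Fin 2) ℂ :=
  ⟨!![1, 0; s, 1], by simp [Matrix.det_fin_two]⟩

/-- `SL₂(ℂ)` is generated by its unitriangular matrices. -/
theorem unitriangular_induction {p : Matrix.SpecialLinearGroup (Fin 2) ℂ → Prop}
    (hu : ∀ s, p (upper s)) (hl : ∀ s, p (lower s)) (hmul : ∀ g h, p g → p h → p (g * h))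
    (g : Matrix.SpecialLinearGroup (Fin 2) ℂ) : p g := by
  have hne : ∀ g : Matrix.SpecialLinearGroup (Fin 2) ℂ, g.1 1 0 ≠ 0 → p g := by
    intro g h
    have hdet := g.2
    rw [Matrix.det_fin_two] at hdet
    have : g = upper ((g.1 0 0 - 1) / g.1 1 0) * lower (g.1 1 0) *
        upper ((g.1 1 1 - 1) / g.1 1 0) := by
      apply Subtype.ext
      rw [Matrix.SpecialLinearGroup.coe_mul, Matrix.SpecialLinearGroup.coe_mul]
      ext i j
      fin_cases i <;> fin_cases j <;> simp [upper, lower, Matrix.mul_apply, Fin.sum_univ_two]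
      · field_simp
        ring
      · field_simp
        linear_combination -hdet
      · field_simp
        ring
    rw [this]
    exact hmul _ _ (hmul _ _ (hu _) (hl _)) (hu _)
  by_cases h : g.1 1 0 = 0
  · -- multiplying by `lower 1` makes the lower left entry nonzero
    have hdet := g.2
    rw [Matrix.det_fin_two, h, mul_zero, sub_zero] at hdet
    have h00 : g.1 0 0 ≠ 0 := left_ne_zero_of_mul_eq_one hdet
    have : g = lower (-1) * (lower 1 * g) := by
      have h1 : lower (-1) * lower 1 = 1 := by
        apply Subtype.ext
        rw [Matrix.SpecialLinearGroup.coe_mul]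
        ext i j
        fin_cases i <;> fin_cases j <;> simp [lower, Matrix.mul_apply, Fin.sum_univ_two]
      rw [← mul_assoc, h1, one_mul]
    rw [this]
    refine hmul _ _ (hl _) (hne _ ?_)
    rw [Matrix.SpecialLinearGroup.coe_mul]
    simpa [lower, Matrix.mul_apply, Fin.sum_univ_two, h] using h00
  · exact hne g h

theorem coeff_add_C_mul_X_pow_mul {τ : Type*} {p q : τ} (hpq : p ≠ q) (s : ℂ) {a b k l : ℕ}
    (h : a + b = k + l) :
    coeff (Finsupp.single p a + Finsupp.single q b) ((X p + C s * X q) ^ k * X q ^ l) =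
      (k.choose a : ℂ) * s ^ (b - l) := by
  classical
  have hiff : ∀ m n : ℕ, (Finsupp.single p m + Finsupp.single q n =
      Finsupp.single p a + Finsupp.single q b) ↔ m = a ∧ n = b := by
    intro m n
    refine ⟨fun h => ⟨?_, ?_⟩, fun h => by rw [h.1, h.2]⟩
    · simpa [hpq] using DFunLike.congr_fun h p
    · simpa [hpq.symm] using DFunLike.congr_fun h q
  have hterm : ∀ m : ℕ, X p ^ m * (C s * X q) ^ (k - m) * (k.choose m : MvPolynomial τ ℂ) *
      X q ^ l = monomial (Finsupp.single p m + Finsupp.single q (k - m + l))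
        (s ^ (k - m) * (k.choose m : ℂ)) := by
    intro m
    have : (monomial (Finsupp.single p m + Finsupp.single q (k - m + l))
        (s ^ (k - m) * (k.choose m : ℂ)) : MvPolynomial τ ℂ) =
        C (s ^ (k - m) * (k.choose m : ℂ)) * (X p ^ m * X q ^ (k - m + l)) := by
      rw [X_pow_eq_monomial, X_pow_eq_monomial, monomial_mul, C_mul_monomial]
      simp
    rw [this, mul_pow, pow_add, C_mul, C_pow, ← map_natCast C]
    ring
  rw [add_pow, Finset.sum_mul, coeff_sum]
  simp only [hterm, coeff_monomial, hiff]
  by_cases hak : a ≤ k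
  · rw [Finset.sum_eq_single a]
    · rw [if_pos ⟨rfl, by omega⟩, mul_comm, show k - a = b - l by omega]
    · intro m _ hm
      rw [if_neg fun h => hm h.1]
    · intro ha
      exact absurd (Finset.mem_range.mpr (by omega)) ha
  · rw [Nat.choose_eq_zero_of_lt (by omega), Nat.cast_zero, zero_mul]
    refine Finset.sum_eq_zero fun m hm => if_neg ?_
    rintro ⟨rfl, -⟩
    exact hak (by have := Finset.mem_range.mp hm; omega)

theorem act_upper (d : ℕ) (s : ℂ) (c : Fin (d + 1) → ℂ) (i : Fin (d + 1)) :
    act d (upper s) c i =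
      ∑ j : Fin (d + 1), ((d - j : ℕ).choose (d - i) : ℂ) * s ^ (i - j : ℕ) * c j := by
  have hi := i.2
  rw [act, form, map_sum, coeff_sum]
  refine Finset.sum_congr rfl fun j _ => ?_
  have hj := j.2
  have : subst (upper s) (C (c j) * X 0 ^ (d - (j : ℕ)) * X 1 ^ (j : ℕ)) =
      C (c j) * ((X 0 + C s * X 1) ^ (d - (j : ℕ)) * X 1 ^ (j : ℕ)) := by
    simp [subst, upper, Fin.sum_univ_two, mul_assoc, algebraMap_eq]
  rw [this, coeff_C_mul, coeff_add_C_mul_X_pow_mul (by decide) s (by omega)]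
  ring

theorem act_lower (d : ℕ) (s : ℂ) (c : Fin (d + 1) → ℂ) (i : Fin (d + 1)) :
    act d (lower s) c i =
      ∑ j : Fin (d + 1), ((j : ℕ).choose i : ℂ) * s ^ (j - i : ℕ) * c j := by
  have hi := i.2
  rw [act, form, map_sum, coeff_sum]
  refine Finset.sum_congr rfl fun j _ => ?_
  have hj := j.2
  have : subst (lower s) (C (c j) * X 0 ^ (d - (j : ℕ)) * X 1 ^ (j : ℕ)) =
      C (c j) * ((X 1 + C s * X 0) ^ (j : ℕ) * X 0 ^ (d - (j : ℕ))) := by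
    simp only [subst, lower, map_mul, map_pow, algHom_C, algebraMap_eq, aeval_X,
      Fin.sum_univ_two]
    simp
    ring
  rw [this, coeff_C_mul, add_comm (Finsupp.single 0 _),
    coeff_add_C_mul_X_pow_mul (by decide) s (by omega)]
  by_cases h : (i : ℕ) ≤ j
  · rw [show d - (i : ℕ) - (d - (j : ℕ)) = j - i by omega]
    ring
  · rw [Nat.choose_eq_zero_of_lt (by omega)]
    simp

end BinaryForms

/-! ### The raising and lowering derivations -/

section Derivations

open MvPolynomial

variable {σ : Type*}

/-- A derivation that shifts the weight of every variable by `δ` shifts all weights by `δ`. -/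
theorem IsWeightedHomogeneous.derivation [Fintype σ] {M : Type*} [AddCommGroup M] {w : σ → M}
    {δ : M} {D : Derivation ℂ (MvPolynomial σ ℂ) (MvPolynomial σ ℂ)}
    (hD : ∀ i, IsWeightedHomogeneous w (D (X i)) (w i + δ)) {F : MvPolynomial σ ℂ} {μ : M}
    (hF : IsWeightedHomogeneous w F μ) : IsWeightedHomogeneous w (D F) (μ + δ) := by
  classical
  have hsum : D = ∑ i, D (X i) • pderiv i := by
    refine derivation_ext fun j => ?_
    rw [← Derivation.coeFnAddMonoidHom_apply (∑ i, D (X i) • pderiv i), map_sum]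
    simp [pderiv_X, Pi.single_apply]
  have hval : D F = ∑ i, D (X i) * pderiv i F := by
    conv_lhs => rw [hsum, ← Derivation.coeFnAddMonoidHom_apply, map_sum]
    simp
  rw [hval]
  refine IsWeightedHomogeneous.sum _ _ _ fun i _ => ?_
  have h := (hD i).mul (hF.pderiv (i := i) (n' := μ - w i) (sub_add_cancel _ _))
  rwa [show w i + δ + (μ - w i) = μ + δ by abel] at h

theorem coeff_mkDerivation_C_mul_X [Fintype σ] (a : σ → ℂ) (F : MvPolynomial σ ℂ) (m : σ →₀ ℕ) :
    coeff m (mkDerivation ℂ (fun i => C (a i) * X i) F) = (∑ i, (m i : ℂ) * a i) * coeff m F := by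
  classical
  induction F using MvPolynomial.induction_on' with
  | add p q hp hq => rw [map_add, coeff_add, hp, hq, coeff_add, mul_add]
  | monomial s r =>
    have hterm : ∀ i ∈ s.support, (monomial (s - Finsupp.single i 1) ((s i : ℕ) : ℂ)) •
        (C (a i) * X i : MvPolynomial σ ℂ) = monomial s ((s i : ℂ) * a i) := by
      intro i hi
      have hle : Finsupp.single i 1 ≤ s :=
        Finsupp.single_le_iff.mpr (Nat.one_le_iff_ne_zero.mpr (Finsupp.mem_support_iff.mp hi))
      rw [smul_eq_mul, mul_left_comm, X, monomial_mul, C_mul_monomial, tsub_add_cancel_of_le hle,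
        mul_one, mul_comm]
    rw [mkDerivation_monomial, Finsupp.sum, Finset.sum_congr rfl hterm, ← map_sum, smul_monomial,
      coeff_monomial, coeff_monomial]
    split_ifs with h
    · subst h
      rw [Finset.sum_subset (Finset.subset_univ _)]
      · rw [smul_eq_mul, mul_comm]
      · intro i _ hi
        simp [Finsupp.notMem_support_iff.mp hi]
    · simp

end Derivations

namespace BinaryForms

open MvPolynomial

section Block

variable {σ : Type*} (d : ℕ) (ι : Fin (d + 1) → σ)

/-- The image `(d - i + 1) X_{i-1}` of the `i`-th coefficient of a form of degree `d` under the
raising derivation; the variables of the form are `X (ι i)`. -/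
noncomputable def raiseX (i : Fin (d + 1)) : MvPolynomial σ ℂ :=
  ∑ j : Fin (d + 1), if (j : ℕ) + 1 = i then C ((d : ℂ) - j) * X (ι j) else 0

/-- The image `(i + 1) X_{i+1}` of the `i`-th coefficient of a form of degree `d` under the
lowering derivation; the variables of the form are `X (ι i)`. -/
noncomputable def lowerX (i : Fin (d + 1)) : MvPolynomial σ ℂ :=
  ∑ j : Fin (d + 1), if (i : ℕ) + 1 = j then C (j : ℂ) * X (ι j) else 0

variable {d}

theorem raiseX_of_add_one_eq {i j : Fin (d + 1)} (h : (j : ℕ) + 1 = i) :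
    raiseX d ι i = C ((d : ℂ) - j) * X (ι j) := by
  rw [raiseX, Finset.sum_eq_single j, if_pos h]
  · intro k _ hk
    exact if_neg fun h2 => hk (Fin.ext (by omega))
  · simp

theorem raiseX_of_eq_zero {i : Fin (d + 1)} (h : (i : ℕ) = 0) : raiseX d ι i = 0 :=
  Finset.sum_eq_zero fun _ _ => if_neg (by omega)

theorem lowerX_of_add_one_eq {i j : Fin (d + 1)} (h : (i : ℕ) + 1 = j) :
    lowerX d ι i = C (j : ℂ) * X (ι j) := by
  rw [lowerX, Finset.sum_eq_single j, if_pos h]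
  · intro k _ hk
    exact if_neg fun h2 => hk (Fin.ext (by omega))
  · simp

theorem lowerX_of_eq {i : Fin (d + 1)} (h : (i : ℕ) = d) : lowerX d ι i = 0 :=
  Finset.sum_eq_zero fun j _ => if_neg (by have := j.2; omega)

/-- The commutator of the raising and the lowering derivation multiplies the `i`-th coefficient
by its weight `d - 2 i`. -/
theorem raise_lower_commutator_X {D E : Derivation ℂ (MvPolynomial σ ℂ) (MvPolynomial σ ℂ)}
    (hD : ∀ i, D (X (ι i)) = raiseX d ι i) (hE : ∀ i, E (X (ι i)) = lowerX d ι i)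
    (i : Fin (d + 1)) :
    D (E (X (ι i))) - E (D (X (ι i))) = C ((d : ℂ) - 2 * i) * X (ι i) := by
  have hi := i.2
  have h1 : D (E (X (ι i))) = C (((i : ℂ) + 1) * (d - i)) * X (ι i) := by
    rw [hE]
    by_cases h : (i : ℕ) = d
    · rw [lowerX_of_eq ι h, map_zero, h]
      simp
    · rw [lowerX_of_add_one_eq ι (j := ⟨i + 1, by omega⟩) rfl, Derivation.leibniz, derivation_C,
        smul_zero, add_zero, smul_eq_mul, hD, raiseX_of_add_one_eq ι (j := i) rfl, ← mul_assoc, ← C_mul]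
      push_cast
      rfl
  have h2 : E (D (X (ι i))) = C ((i : ℂ) * (d - i + 1)) * X (ι i) := by
    rw [hD]
    by_cases h : (i : ℕ) = 0
    · rw [raiseX_of_eq_zero ι h, map_zero, h]
      simp
    · obtain ⟨k, hk⟩ := Nat.exists_eq_succ_of_ne_zero h
      rw [raiseX_of_add_one_eq ι (j := ⟨k, by omega⟩) hk.symm, Derivation.leibniz,
        derivation_C, smul_zero, add_zero, smul_eq_mul, hE,
        lowerX_of_add_one_eq ι (j := i) hk.symm, ← mul_assoc, ← C_mul, hk]
      congr 2
      push_cast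
      ring
  rw [h1, h2, ← sub_mul, ← C_sub]
  congr 2
  ring

theorem isWeightedHomogeneous_raiseX {w : σ → ℤ × ℤ}
    (hw : ∀ i, w (ι i) = (1, (d : ℤ) - 2 * (i : ℕ))) (i : Fin (d + 1)) :
    IsWeightedHomogeneous w (raiseX d ι i) (w (ι i) + (0, 2)) := by
  refine IsWeightedHomogeneous.sum _ _ _ fun j _ => ?_
  split_ifs with h
  · convert! (isWeightedHomogeneous_X ℂ w (ι j)).C_mul _ using 1
    rw [hw, hw, ← h, Prod.mk_add_mk]
    congr 1
    push_cast
    ring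
  · exact isWeightedHomogeneous_zero ℂ w _

theorem isWeightedHomogeneous_lowerX {w : σ → ℤ × ℤ}
    (hw : ∀ i, w (ι i) = (1, (d : ℤ) - 2 * (i : ℕ))) (i : Fin (d + 1)) :
    IsWeightedHomogeneous w (lowerX d ι i) (w (ι i) + (0, -2)) := by
  refine IsWeightedHomogeneous.sum _ _ _ fun j _ => ?_
  split_ifs with h
  · convert! (isWeightedHomogeneous_X ℂ w (ι j)).C_mul _ using 1
    rw [hw, hw, ← h, Prod.mk_add_mk]
    congr 1
    push_cast
    ring
  · exact isWeightedHomogeneous_zero ℂ w _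

/-- The entries of `act d (upper s) c`, as polynomials in `s`. -/
noncomputable def upperCurve (c : Fin (d + 1) → ℂ) (i : Fin (d + 1)) : Polynomial ℂ :=
  ∑ j : Fin (d + 1), Polynomial.C (((d - j : ℕ).choose (d - i) : ℂ) * c j) *
    Polynomial.X ^ (i - j : ℕ)

/-- The entries of `act d (lower s) c`, as polynomials in `s`. -/
noncomputable def lowerCurve (c : Fin (d + 1) → ℂ) (i : Fin (d + 1)) : Polynomial ℂ :=
  ∑ j : Fin (d + 1), Polynomial.C (((j : ℕ).choose i : ℂ) * c j) * Polynomial.X ^ (j - i : ℕ)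

theorem eval_upperCurve (c : Fin (d + 1) → ℂ) (s : ℂ) (i : Fin (d + 1)) :
    (upperCurve c i).eval s = act d (upper s) c i := by
  rw [upperCurve, act_upper, Polynomial.eval_finsetSum]
  refine Finset.sum_congr rfl fun j _ => ?_
  simp
  ring

theorem eval_lowerCurve (c : Fin (d + 1) → ℂ) (s : ℂ) (i : Fin (d + 1)) :
    (lowerCurve c i).eval s = act d (lower s) c i := by
  rw [lowerCurve, act_lower, Polynomial.eval_finsetSum]
  refine Finset.sum_congr rfl fun j _ => ?_
  simp
  ring

theorem act_upper_zero (c : Fin (d + 1) → ℂ) : act d (upper 0) c = c := by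
  funext i
  have hi := i.2
  rw [act_upper, Finset.sum_eq_single i]
  · simp
  · intro j _ hj
    rcases Nat.lt_or_gt_of_ne (fun h => hj (Fin.ext h) : (j : ℕ) ≠ i) with h | h
    · rw [zero_pow (by omega)]
      simp
    · rw [Nat.choose_eq_zero_of_lt (by omega)]
      simp
  · simp

theorem act_lower_zero (c : Fin (d + 1) → ℂ) : act d (lower 0) c = c := by
  funext i
  rw [act_lower, Finset.sum_eq_single i]
  · simp
  · intro j _ hj
    rcases Nat.lt_or_gt_of_ne (fun h => hj (Fin.ext h) : (j : ℕ) ≠ i) with h | h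
    · rw [Nat.choose_eq_zero_of_lt h]
      simp
    · rw [zero_pow (by omega)]
      simp
  · simp

theorem derivative_upperCurve (c : Fin (d + 1) → ℂ) {γ : σ → Polynomial ℂ}
    (hγ : ∀ i, γ (ι i) = upperCurve c i) (i : Fin (d + 1)) :
    Polynomial.derivative (upperCurve c i) = aeval γ (raiseX d ι i) := by
  have hi := i.2
  by_cases h : (i : ℕ) = 0
  · rw [raiseX_of_eq_zero ι h, upperCurve]
    simp [h]
  · obtain ⟨k, hk⟩ := Nat.exists_eq_succ_of_ne_zero h
    rw [raiseX_of_add_one_eq ι (j := ⟨k, by omega⟩) hk.symm, map_mul, aeval_X, hγ,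
      upperCurve, upperCurve, Polynomial.derivative_sum, Finset.mul_sum]
    refine Finset.sum_congr rfl fun j _ => ?_
    have hj := j.2
    have hch : ((d - j : ℕ).choose (d - i) : ℂ) * (i - j : ℕ) =
        ((d : ℂ) - k) * ((d - j : ℕ).choose (d - k) : ℂ) := by
      by_cases hji : (j : ℕ) ≤ i
      · have h2 := Nat.choose_succ_right_eq (d - j) (d - i)
        rw [show d - (i : ℕ) + 1 = d - k by omega,
          show d - (j : ℕ) - (d - i) = i - j by omega] at h2
        rw [← Nat.cast_sub (by omega)]
        exact_mod_cast h2.symm.trans (mul_comm _ _)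
      · rw [Nat.choose_eq_zero_of_lt (by omega), Nat.choose_eq_zero_of_lt (by omega)]
        simp
    rw [Polynomial.derivative_C_mul, Polynomial.derivative_X_pow, algHom_C,
      Polynomial.algebraMap_eq, show (i : ℕ) - j - 1 = k - j by omega, ← mul_assoc, ← mul_assoc,
      ← Polynomial.C_mul, ← Polynomial.C_mul]
    congr 2
    linear_combination c j * hch

theorem derivative_lowerCurve (c : Fin (d + 1) → ℂ) {γ : σ → Polynomial ℂ}
    (hγ : ∀ i, γ (ι i) = lowerCurve c i) (i : Fin (d + 1)) :
    Polynomial.derivative (lowerCurve c i) = aeval γ (lowerX d ι i) := by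
  have hi := i.2
  by_cases h : (i : ℕ) = d
  · rw [lowerX_of_eq ι h, lowerCurve, map_zero, Polynomial.derivative_sum]
    refine Finset.sum_eq_zero fun j _ => ?_
    have hj := j.2
    rw [show (j : ℕ) - i = 0 by omega]
    simp
  · rw [lowerX_of_add_one_eq ι (j := ⟨i + 1, by omega⟩) rfl, map_mul, aeval_X, hγ,
      lowerCurve, lowerCurve, Polynomial.derivative_sum, Finset.mul_sum]
    refine Finset.sum_congr rfl fun j _ => ?_
    have hch : ((j : ℕ).choose i : ℂ) * (j - i : ℕ) =
        ((i + 1 : ℕ) : ℂ) * ((j : ℕ).choose (i + 1) : ℂ) := by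
      exact_mod_cast (Nat.choose_succ_right_eq j i).symm.trans (mul_comm _ _)
    rw [Polynomial.derivative_C_mul, Polynomial.derivative_X_pow, algHom_C,
      Polynomial.algebraMap_eq, show (j : ℕ) - i - 1 = j - (i + 1) by omega, ← mul_assoc,
      ← mul_assoc, ← Polynomial.C_mul, ← Polynomial.C_mul]
    congr 2
    linear_combination c j * hch

end Block

variable (d₁ d₂ : ℕ)

/-- The derivation generating the action of the upper unitriangular matrices. -/
noncomputable def raising : Derivation ℂ (MvPolynomial (Fin (d₁ + 1) ⊕ Fin (d₂ + 1)) ℂ)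
    (MvPolynomial (Fin (d₁ + 1) ⊕ Fin (d₂ + 1)) ℂ) :=
  mkDerivation ℂ (Sum.elim (raiseX d₁ Sum.inl) (raiseX d₂ Sum.inr))

/-- The derivation generating the action of the lower unitriangular matrices. -/
noncomputable def lowering : Derivation ℂ (MvPolynomial (Fin (d₁ + 1) ⊕ Fin (d₂ + 1)) ℂ)
    (MvPolynomial (Fin (d₁ + 1) ⊕ Fin (d₂ + 1)) ℂ) :=
  mkDerivation ℂ (Sum.elim (lowerX d₁ Sum.inl) (lowerX d₂ Sum.inr))

/-- The weight of a coefficient under the diagonal torus. -/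
def torusWeight : Fin (d₁ + 1) ⊕ Fin (d₂ + 1) → ℤ :=
  Sum.elim (fun i => (d₁ : ℤ) - 2 * (i : ℕ)) (fun i => (d₂ : ℤ) - 2 * (i : ℕ))

variable {d₁ d₂}

/-- Invariance under `SL₂` is invariance under both unitriangular subgroups, and each of these is
detected by its derivation. -/
theorem mem_jointInvariants_iff {F : MvPolynomial (Fin (d₁ + 1) ⊕ Fin (d₂ + 1)) ℂ} :
    F ∈ jointInvariants d₁ d₂ ↔ raising d₁ d₂ F = 0 ∧ lowering d₁ d₂ F = 0 := by
  have hup := forall_eval_curve_iff (raising d₁ d₂)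
    (fun c => Sum.elim (upperCurve fun i => c (Sum.inl i)) (upperCurve fun i => c (Sum.inr i)))
    (by rintro c (i | i) <;> simp [eval_upperCurve, act_upper_zero])
    (by
      rintro c (i | i)
      · rw [raising, mkDerivation_X]
        exact derivative_upperCurve Sum.inl _ (fun _ => rfl) i
      · rw [raising, mkDerivation_X]
        exact derivative_upperCurve Sum.inr _ (fun _ => rfl) i) F
  have hlow := forall_eval_curve_iff (lowering d₁ d₂)
    (fun c => Sum.elim (lowerCurve fun i => c (Sum.inl i)) (lowerCurve fun i => c (Sum.inr i)))
    (by rintro c (i | i) <;> simp [eval_lowerCurve, act_lower_zero])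
    (by
      rintro c (i | i)
      · rw [lowering, mkDerivation_X]
        exact derivative_lowerCurve Sum.inl _ (fun _ => rfl) i
      · rw [lowering, mkDerivation_X]
        exact derivative_lowerCurve Sum.inr _ (fun _ => rfl) i) F
  have hcu : ∀ (s : ℂ) (p : Fin (d₁ + 1) → ℂ) (q : Fin (d₂ + 1) → ℂ),
      (fun i => (Sum.elim (upperCurve p) (upperCurve q) i).eval s) =
        Sum.elim (act d₁ (upper s) p) (act d₂ (upper s) q) := by
    intro s p q
    funext i
    rcases i with i | i <;> simp [eval_upperCurve]
  have hcl : ∀ (s : ℂ) (p : Fin (d₁ + 1) → ℂ) (q : Fin (d₂ + 1) → ℂ),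
      (fun i => (Sum.elim (lowerCurve p) (lowerCurve q) i).eval s) =
        Sum.elim (act d₁ (lower s) p) (act d₂ (lower s) q) := by
    intro s p q
    funext i
    rcases i with i | i <;> simp [eval_lowerCurve]
  simp only [hcu, hcl] at hup hlow
  rw [← hup, ← hlow]
  have hsplit : ∀ c : Fin (d₁ + 1) ⊕ Fin (d₂ + 1) → ℂ,
      Sum.elim (fun i => c (Sum.inl i)) (fun i => c (Sum.inr i)) = c := fun c => by
    funext i
    rcases i with i | i <;> rfl
  constructor
  · intro h
    exact ⟨fun s c => (h _ _ _).trans (by rw [hsplit]),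
      fun s c => (h _ _ _).trans (by rw [hsplit])⟩
  · rintro ⟨hu, hl⟩ g
    induction g using unitriangular_induction with
    | hu s => exact fun p q => hu s (Sum.elim p q)
    | hl s => exact fun p q => hl s (Sum.elim p q)
    | hmul g h hg hh =>
      intro p q
      rw [act_mul, act_mul, hh, hg]

theorem raising_lowering_commutator (F : MvPolynomial (Fin (d₁ + 1) ⊕ Fin (d₂ + 1)) ℂ) :
    raising d₁ d₂ (lowering d₁ d₂ F) - lowering d₁ d₂ (raising d₁ d₂ F) =
      mkDerivation ℂ (fun i => C (torusWeight d₁ d₂ i : ℂ) * X i) F := by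
  have : ⁅raising d₁ d₂, lowering d₁ d₂⁆ =
      mkDerivation ℂ (fun i => C (torusWeight d₁ d₂ i : ℂ) * X i) := by
    refine derivation_ext fun i => ?_
    rw [Derivation.commutator_apply, mkDerivation_X]
    rcases i with i | i
    · rw [raise_lower_commutator_X Sum.inl (fun i => by rw [raising, mkDerivation_X]; rfl)
        (fun i => by rw [lowering, mkDerivation_X]; rfl)]
      simp [torusWeight]
    · rw [raise_lower_commutator_X Sum.inr (fun i => by rw [raising, mkDerivation_X]; rfl)
        (fun i => by rw [lowering, mkDerivation_X]; rfl)]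
      simp [torusWeight]
  rw [← this, Derivation.commutator_apply]

/-! ### The dimension of the space of joint invariants -/

variable (d₁ d₂) in
/-- The span of the monomials of degree `n` and torus weight `w`. -/
noncomputable def weightSpace (n : ℕ) (w : ℤ) :
    Submodule ℂ (MvPolynomial (Fin (d₁ + 1) ⊕ Fin (d₂ + 1)) ℂ) :=
  weightedHomogeneousSubmodule ℂ (fun i => ((1 : ℤ), torusWeight d₁ d₂ i)) ((n : ℤ), w)

theorem weight_torusWeight_eq_iff {n : ℕ} {w : ℤ} {m : Fin (d₁ + 1) ⊕ Fin (d₂ + 1) →₀ ℕ} :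
    Finsupp.weight (fun i => ((1 : ℤ), torusWeight d₁ d₂ i)) m = ((n : ℤ), w) ↔
      ∑ i, m i = n ∧ ∑ i, (m i : ℤ) * torusWeight d₁ d₂ i = w := by
  rw [Finsupp.weight_apply, Finsupp.sum_fintype _ _ (by simp), Prod.ext_iff, Prod.fst_sum,
    Prod.snd_sum]
  simp only [Prod.smul_mk, nsmul_eq_mul, mul_one]
  norm_cast

theorem mem_weightSpace_iff {n : ℕ} {w : ℤ}
    {F : MvPolynomial (Fin (d₁ + 1) ⊕ Fin (d₂ + 1)) ℂ} :
    F ∈ weightSpace d₁ d₂ n w ↔ ∀ m, coeff m F ≠ 0 →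
      ∑ i, m i = n ∧ ∑ i, (m i : ℤ) * torusWeight d₁ d₂ i = w := by
  simp only [weightSpace, mem_weightedHomogeneousSubmodule, IsWeightedHomogeneous,
    weight_torusWeight_eq_iff]

variable (d₁ d₂) in
/-- The exponents of the monomials of degree `n` and torus weight `w`. -/
noncomputable def weightMonomials (n : ℕ) (w : ℤ) :
    Finset (Fin (d₁ + 1) ⊕ Fin (d₂ + 1) →₀ ℕ) :=
  (Finset.finsuppAntidiag Finset.univ n).filter
    fun m => ∑ i, (m i : ℤ) * torusWeight d₁ d₂ i = w

theorem weightSpace_eq_restrictSupport (n : ℕ) (w : ℤ) :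
    weightSpace d₁ d₂ n w = restrictSupport ℂ (weightMonomials d₁ d₂ n w : Set _) := by
  ext F
  rw [mem_weightSpace_iff, mem_restrictSupport_iff]
  simp [Set.subset_def, weightMonomials, Finset.mem_finsuppAntidiag]

theorem finrank_weightSpace (n : ℕ) (w : ℤ) :
    Module.finrank ℂ (weightSpace d₁ d₂ n w) = (weightMonomials d₁ d₂ n w).card := by
  rw [weightSpace_eq_restrictSupport, Module.finrank_eq_card_basis (basisRestrictSupport ℂ _)]
  simp

instance (n : ℕ) (w : ℤ) : FiniteDimensional ℂ (weightSpace d₁ d₂ n w) := by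
  rw [weightSpace_eq_restrictSupport]
  exact (basisRestrictSupport ℂ _).finiteDimensional_of_finite

theorem abs_torusWeight_le (i : Fin (d₁ + 1) ⊕ Fin (d₂ + 1)) :
    |torusWeight d₁ d₂ i| ≤ d₁ + d₂ := by
  rcases i with i | i <;> have := i.2 <;> simp only [torusWeight, Sum.elim_inl, Sum.elim_inr] <;>
    rw [abs_le] <;> omega

theorem weightSpace_eq_bot {n : ℕ} {w : ℤ} (hw : (n : ℤ) * (d₁ + d₂) < |w|) :
    weightSpace d₁ d₂ n w = ⊥ := by
  rw [eq_bot_iff]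
  intro F hF
  rw [Submodule.mem_bot]
  ext m
  by_contra hm
  obtain ⟨h1, h2⟩ := mem_weightSpace_iff.mp hF m hm
  refine absurd hw (not_lt.mpr ?_)
  rw [← h2, ← h1]
  push_cast
  rw [Finset.sum_mul]
  refine (Finset.abs_sum_le_sum_abs _ _).trans (Finset.sum_le_sum fun i _ => ?_)
  rw [abs_mul, Nat.abs_cast]
  exact mul_le_mul_of_nonneg_left (abs_torusWeight_le i) (by positivity)

theorem raising_mem_weightSpace {n : ℕ} (w : ℤ) :
    ∀ F ∈ weightSpace d₁ d₂ n w, raising d₁ d₂ F ∈ weightSpace d₁ d₂ n (w + 2) := by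
  intro F hF
  have h := IsWeightedHomogeneous.derivation (D := raising d₁ d₂) (δ := ((0 : ℤ), (2 : ℤ))) (by
    rintro (i | i)
    · rw [raising, mkDerivation_X]
      exact isWeightedHomogeneous_raiseX Sum.inl (fun _ => rfl) i
    · rw [raising, mkDerivation_X]
      exact isWeightedHomogeneous_raiseX Sum.inr (fun _ => rfl) i)
    ((mem_weightedHomogeneousSubmodule ℂ _ _ F).mp hF)
  rwa [Prod.mk_add_mk, add_zero] at h

theorem lowering_mem_weightSpace {n : ℕ} (w : ℤ) :
    ∀ F ∈ weightSpace d₁ d₂ n w, lowering d₁ d₂ F ∈ weightSpace d₁ d₂ n (w - 2) := by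
  intro F hF
  have h := IsWeightedHomogeneous.derivation (D := lowering d₁ d₂) (δ := ((0 : ℤ), (-2 : ℤ))) (by
    rintro (i | i)
    · rw [lowering, mkDerivation_X]
      exact isWeightedHomogeneous_lowerX Sum.inl (fun _ => rfl) i
    · rw [lowering, mkDerivation_X]
      exact isWeightedHomogeneous_lowerX Sum.inr (fun _ => rfl) i)
    ((mem_weightedHomogeneousSubmodule ℂ _ _ F).mp hF)
  rwa [Prod.mk_add_mk, add_zero] at h

theorem commutator_eq_smul {n : ℕ} (w : ℤ) :
    ∀ F ∈ weightSpace d₁ d₂ n w, raising d₁ d₂ (lowering d₁ d₂ F) -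
      lowering d₁ d₂ (raising d₁ d₂ F) = (w : ℂ) • F := by
  intro F hF
  rw [raising_lowering_commutator]
  ext m
  rw [coeff_mkDerivation_C_mul_X, coeff_smul, smul_eq_mul]
  by_cases hm : coeff m F = 0
  · rw [hm, mul_zero, mul_zero]
  · rw [← (mem_weightSpace_iff.mp hF m hm).2]
    push_cast
    rfl

/-- The invariants of degree `n` are the vectors of weight `0` killed by the lowering derivation:
a polynomial killed by both derivations has weight `0`, as their commutator acts by the weight. -/
theorem jointInvariantsOfDegree_eq (n : ℕ) :
    jointInvariantsOfDegree d₁ d₂ n =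
      weightSpace d₁ d₂ n 0 ⊓ LinearMap.ker (lowering d₁ d₂).toLinearMap := by
  ext F
  rw [jointInvariantsOfDegree, Submodule.mem_inf, Submodule.mem_inf, Subalgebra.mem_toSubmodule,
    mem_jointInvariants_iff, mem_homogeneousSubmodule, LinearMap.mem_ker]
  constructor
  · rintro ⟨⟨hu, hl⟩, hn⟩
    refine ⟨mem_weightSpace_iff.mpr fun m hm => ⟨?_, ?_⟩, hl⟩
    · have h := hn hm
      rwa [Finsupp.weight_apply, Finsupp.sum_fintype _ _ (by simp),
        Finset.sum_congr rfl (fun i _ => by rw [Pi.one_apply, smul_eq_mul, mul_one])] at h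
    · have h := raising_lowering_commutator F
      rw [hu, hl, map_zero, map_zero, sub_zero] at h
      have h2 := coeff_mkDerivation_C_mul_X (fun i => (torusWeight d₁ d₂ i : ℂ)) F m
      rw [← h, coeff_zero] at h2
      exact_mod_cast (mul_eq_zero.mp h2.symm).resolve_right hm
  · rintro ⟨hF, hl⟩
    refine ⟨⟨?_, hl⟩, fun m hm => ?_⟩
    · exact raise_eq_zero_of_lower_eq_zero (u := (raising d₁ d₂).toLinearMap)
        (d := (lowering d₁ d₂).toLinearMap) raising_mem_weightSpace commutator_eq_smul
        (fun w hw => weightSpace_eq_bot hw) hF hl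
    · rw [Finsupp.weight_apply, Finsupp.sum_fintype _ _ (by simp),
        ← (mem_weightSpace_iff.mp hF m hm).1]
      simp

/-- The Cayley–Sylvester formula. -/
theorem finrank_jointInvariantsOfDegree_add (n : ℕ) :
    Module.finrank ℂ (jointInvariantsOfDegree d₁ d₂ n) + (weightMonomials d₁ d₂ n (-2)).card =
      (weightMonomials d₁ d₂ n 0).card := by
  rw [← finrank_weightSpace, ← finrank_weightSpace, jointInvariantsOfDegree_eq]
  exact finrank_ker_lower_add (u := (raising d₁ d₂).toLinearMap)
    (d := (lowering d₁ d₂).toLinearMap) (W := weightSpace d₁ d₂ n) raising_mem_weightSpace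
    lowering_mem_weightSpace commutator_eq_smul (fun w hw => weightSpace_eq_bot hw)

end BinaryForms

/-! ### Partial fractions and complete homogeneous sums -/

section PartialFractions

open Finset

variable {K ι : Type*} [Field K] [Fintype ι] [DecidableEq ι]

/-- The partial fraction decomposition of `1 / ∏ i, (1 - x i * T)` with denominators cleared. It
is the partition of unity by the Lagrange basis polynomials at the nodes `(x i)⁻¹`. -/
theorem sum_C_prod_mul_prod_one_sub_eq_one [Nonempty ι] {x : ι → K}
    (hx : Function.Injective x) (hx0 : ∀ i, x i ≠ 0) :
    ∑ i, Polynomial.C (∏ j ∈ univ.erase i, (1 - x j / x i)⁻¹) *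
      ∏ j ∈ univ.erase i, (1 - Polynomial.C (x j) * Polynomial.X) = 1 := by
  refine Eq.trans ?_ (Lagrange.sum_basis (s := univ) (v := fun i => (x i)⁻¹)
    (fun i _ j _ h => hx (inv_injective h)) univ_nonempty)
  refine sum_congr rfl fun i _ => ?_
  rw [map_prod, ← prod_mul_distrib, Lagrange.basis]
  refine prod_congr rfl fun j hj => ?_
  have hij : x i - x j ≠ 0 := sub_ne_zero.mpr fun h => (mem_erase.mp hj).1 (hx h).symm
  have hij' : x j - x i ≠ 0 := by rwa [← neg_sub, neg_ne_zero]
  have hi := hx0 i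
  have hj0 := hx0 j
  have h1 : (1 - x j / x i)⁻¹ = x i / (x i - x j) := by field_simp
  have h2 : ((x i)⁻¹ - (x j)⁻¹)⁻¹ = -(x j * (x i / (x i - x j))) := by
    field_simp
    ring
  have h3 : Polynomial.C (x j) * Polynomial.C (x j)⁻¹ = 1 := by
    rw [← Polynomial.C_mul, mul_inv_cancel₀ hj0, Polynomial.C_1]
  rw [Lagrange.basisDivisor, h1, h2, Polynomial.C_neg, Polynomial.C_mul]
  linear_combination -Polynomial.C (x i / (x i - x j)) * h3

/-- The sum of all monomials of degree `n` in the values `x i`. -/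
def completeHomogeneous {R : Type*} [CommSemiring R] (x : ι → R) (n : ℕ) : R :=
  ∑ m ∈ finsuppAntidiag univ n, ∏ i, x i ^ m i

theorem one_sub_C_mul_X_mul_mk_pow (a : K) :
    (1 - PowerSeries.C a * PowerSeries.X) * PowerSeries.mk (fun n => a ^ n) = 1 := by
  ext n
  rw [sub_mul, one_mul, map_sub, mul_assoc, PowerSeries.coeff_C_mul]
  cases n with
  | zero => simp
  | succ n => simp [PowerSeries.coeff_succ_X_mul, pow_succ', PowerSeries.coeff_one]

/-- The coefficient of `T ^ n` in the partial fraction decomposition of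
`1 / ∏ i, (1 - x i * T)`. -/
theorem completeHomogeneous_eq_sum [Nonempty ι] {x : ι → K}
    (hx : Function.Injective x) (hx0 : ∀ i, x i ≠ 0) (n : ℕ) :
    completeHomogeneous x n = ∑ i, (∏ j ∈ univ.erase i, (1 - x j / x i)⁻¹) * x i ^ n := by
  let g : ι → PowerSeries K := fun i => PowerSeries.mk fun n => x i ^ n
  have hg : ∀ i, (1 - PowerSeries.C (x i) * PowerSeries.X) * g i = 1 := fun i =>
    one_sub_C_mul_X_mul_mk_pow (x i)
  have h := congrArg (fun p : Polynomial K => (p : PowerSeries K) * ∏ i, g i)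
    (sum_C_prod_mul_prod_one_sub_eq_one hx hx0)
  have key : ∏ i, g i =
      ∑ i, PowerSeries.C (∏ j ∈ univ.erase i, (1 - x j / x i)⁻¹) * g i := by
    refine Eq.trans (by simp) (h.symm.trans ?_)
    rw [← Polynomial.coeToPowerSeries.ringHom_apply, map_sum, sum_mul]
    refine sum_congr rfl fun i _ => ?_
    generalize ∏ j ∈ univ.erase i, (1 - x j / x i)⁻¹ = a
    rw [← mul_prod_erase univ g (mem_univ i), map_mul, map_prod]
    have : (∏ j ∈ univ.erase i, Polynomial.coeToPowerSeries.ringHom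
        (1 - Polynomial.C (x j) * Polynomial.X)) * ∏ j ∈ univ.erase i, g j = 1 := by
      rw [← prod_mul_distrib]
      exact prod_eq_one fun j _ => by simpa using hg j
    simp only [Polynomial.coeToPowerSeries.ringHom_apply, Polynomial.coe_C] at this ⊢
    linear_combination
      (PowerSeries.C a * g i) * this
  have hc := congrArg (PowerSeries.coeff n) key
  rw [PowerSeries.coeff_prod, map_sum] at hc
  simpa [g, PowerSeries.coeff_C_mul, completeHomogeneous] using hc

end PartialFractions

/-! ### Expansions at the origin -/

namespace BinaryForms

section Expansion

open Finset

theorem IsExpansion.one : IsExpansion 1 1 := by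
  simp [IsExpansion]

theorem IsExpansion.X : IsExpansion RatFunc.X PowerSeries.X := by
  rw [IsExpansion, RatFunc.coe_X, PowerSeries.coe_X]

theorem IsExpansion.mul {R S : RatFunc ℂ} {r s : PowerSeries ℂ} (hR : IsExpansion R r)
    (hS : IsExpansion S s) : IsExpansion (R * S) (r * s) := by
  rw [IsExpansion] at *
  rw [map_mul, map_mul, hR, hS]

theorem IsExpansion.sub {R S : RatFunc ℂ} {r s : PowerSeries ℂ} (hR : IsExpansion R r)
    (hS : IsExpansion S s) : IsExpansion (R - S) (r - s) := by
  rw [IsExpansion] at *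
  rw [map_sub, map_sub, hR, hS]

theorem IsExpansion.neg {R : RatFunc ℂ} {r : PowerSeries ℂ} (hR : IsExpansion R r) :
    IsExpansion (-R) (-r) := by
  rw [IsExpansion] at *
  rw [map_neg, map_neg, hR]

theorem IsExpansion.pow {R : RatFunc ℂ} {r : PowerSeries ℂ} (hR : IsExpansion R r) (n : ℕ) :
    IsExpansion (R ^ n) (r ^ n) := by
  rw [IsExpansion] at *
  rw [map_pow, map_pow, hR]

theorem IsExpansion.sum {ι : Type*} {s : Finset ι} {R : ι → RatFunc ℂ} {r : ι → PowerSeries ℂ}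
    (h : ∀ i ∈ s, IsExpansion (R i) (r i)) : IsExpansion (∑ i ∈ s, R i) (∑ i ∈ s, r i) := by
  rw [IsExpansion, map_sum, map_sum]
  exact sum_congr rfl h

theorem IsExpansion.prod {ι : Type*} {s : Finset ι} {R : ι → RatFunc ℂ} {r : ι → PowerSeries ℂ}
    (h : ∀ i ∈ s, IsExpansion (R i) (r i)) : IsExpansion (∏ i ∈ s, R i) (∏ i ∈ s, r i) := by
  rw [IsExpansion, map_prod, map_prod]
  exact prod_congr rfl h

theorem IsExpansion.inv {R : RatFunc ℂ} {r : PowerSeries ℂ} (hR : IsExpansion R r)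
    (h : PowerSeries.constantCoeff r ≠ 0) : IsExpansion R⁻¹ r⁻¹ := by
  rw [IsExpansion] at *
  rw [map_inv₀, hR]
  refine inv_eq_of_mul_eq_one_right ?_
  rw [← map_mul, PowerSeries.mul_inv_cancel _ h, map_one]

theorem IsExpansion.unique {R : RatFunc ℂ} {r s : PowerSeries ℂ} (hr : IsExpansion R r)
    (hs : IsExpansion R s) : r = s :=
  HahnSeries.ofPowerSeries_injective (Γ := ℤ) (hr.symm.trans hs)

theorem inv_one_sub_zpow_neg {K : Type*} [Field K] {x : K} (hx : x ≠ 0) (a : ℤ) :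
    (1 - x ^ (-a))⁻¹ = -(x ^ a * (1 - x ^ a)⁻¹) := by
  have h : 1 - x ^ (-a) = -(x ^ (-a) * (1 - x ^ a)) := by
    rw [mul_sub, ← zpow_add₀ hx, neg_add_cancel, zpow_zero]
    ring
  rw [h, inv_neg, mul_inv, zpow_neg, inv_inv]

/-- For `m ≠ 0` the function `1 / (1 - z ^ m)` is regular at `0`; it vanishes there if `m < 0`. -/
theorem exists_isExpansion_inv_one_sub_zpow {m : ℤ} (hm : m ≠ 0) :
    ∃ r, IsExpansion (1 - RatFunc.X ^ m)⁻¹ r ∧ (m < 0 → PowerSeries.constantCoeff r = 0) := by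
  have key : ∀ k : ℕ, k ≠ 0 → IsExpansion (1 - RatFunc.X ^ k)⁻¹ (1 - PowerSeries.X ^ k)⁻¹ :=
    fun k hk => (IsExpansion.one.sub (IsExpansion.X.pow k)).inv (by simp [hk])
  obtain ⟨k, rfl | rfl⟩ := m.eq_nat_or_neg
  · refine ⟨_, by simpa using key k (by omega), fun h => by omega⟩
  · refine ⟨-(PowerSeries.X ^ k * (1 - PowerSeries.X ^ k)⁻¹), ?_, fun _ => ?_⟩
    · rw [inv_one_sub_zpow_neg RatFunc.X_ne_zero, zpow_natCast]
      exact ((IsExpansion.X.pow k).mul (key k (by omega))).neg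
    · simp [show k ≠ 0 by omega]

variable {ι : Type*} [Fintype ι] [DecidableEq ι]

/-- The coefficient of `1 / (1 - t z ^ e i)` in the partial fraction decomposition of
`1 / ∏ j, (1 - t z ^ e j)` with respect to `t`. -/
noncomputable def residue (e : ι → ℕ) (i : ι) : RatFunc ℂ :=
  ∏ j ∈ univ.erase i, (1 - RatFunc.X ^ ((e j : ℤ) - e i))⁻¹

theorem exists_isExpansion_residue {e : ι → ℕ} (he : Function.Injective e) (i : ι) :
    ∃ r, IsExpansion (residue e i) r ∧
      ((∃ j, e j < e i) → PowerSeries.constantCoeff r = 0) := by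
  have h : ∀ j : ι, ∃ r, j ∈ univ.erase i →
      IsExpansion (1 - RatFunc.X ^ ((e j : ℤ) - e i))⁻¹ r ∧
        ((e j : ℤ) - e i < 0 → PowerSeries.constantCoeff r = 0) := by
    intro j
    by_cases hj : j ∈ univ.erase i
    · have : (e j : ℤ) - e i ≠ 0 := by
        have := he.ne (mem_erase.mp hj).1
        omega
      obtain ⟨r, hr⟩ := exists_isExpansion_inv_one_sub_zpow this
      exact ⟨r, fun _ => hr⟩
    · exact ⟨0, fun h => absurd h hj⟩
  choose r hr using h
  refine ⟨∏ j ∈ univ.erase i, r j, IsExpansion.prod fun j hj => (hr j hj).1, ?_⟩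
  rintro ⟨j, hj⟩
  have hmem : j ∈ univ.erase i := mem_erase.mpr ⟨by rintro rfl; omega, mem_univ j⟩
  rw [map_prod]
  exact prod_eq_zero hmem ((hr j hmem).2 (by omega))

theorem residue_eq (e : ι → ℕ) (i : ι) :
    residue e i =
      ∏ j ∈ univ.erase i, (1 - (RatFunc.X ^ e j / RatFunc.X ^ e i : RatFunc ℂ))⁻¹ := by
  refine prod_congr rfl fun j _ => ?_
  rw [zpow_sub₀ RatFunc.X_ne_zero, zpow_natCast, zpow_natCast]

theorem X_pow_injective : Function.Injective fun n : ℕ => (RatFunc.X ^ n : RatFunc ℂ) := by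
  intro m n h
  have h2 : (Polynomial.X ^ m : Polynomial ℂ) = Polynomial.X ^ n := by
    apply RatFunc.algebraMap_injective ℂ
    simpa using h
  simpa using congrArg Polynomial.natDegree h2

/-- The partial fraction decomposition of `(1 - z ^ 2) / ∏ i, (1 - t z ^ e i)`, in terms of power
series in `z`: the coefficient of `t ^ n`. -/
theorem mul_completeHomogeneous_X_pow [Nonempty ι] {e : ι → ℕ} (he : Function.Injective e)
    {r : ι → PowerSeries ℂ}
    (hr : ∀ i, IsExpansion ((1 - RatFunc.X ^ 2) * residue e i) (r i)) (n : ℕ) :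
    (1 - PowerSeries.X ^ 2) * completeHomogeneous (fun i => PowerSeries.X ^ e i) n =
      ∑ i, r i * (PowerSeries.X ^ e i) ^ n := by
  have h := completeHomogeneous_eq_sum (x := fun i => (RatFunc.X ^ e i : RatFunc ℂ))
    (X_pow_injective.comp he) (fun i => pow_ne_zero _ RatFunc.X_ne_zero) n
  refine IsExpansion.unique (R := (1 - RatFunc.X ^ 2) *
    completeHomogeneous (fun i => (RatFunc.X ^ e i : RatFunc ℂ)) n) ?_ ?_
  · exact (IsExpansion.one.sub (IsExpansion.X.pow 2)).mul
      (IsExpansion.sum fun m _ => IsExpansion.prod fun i _ => (IsExpansion.X.pow _).pow _)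
  · rw [h, mul_sum]
    refine IsExpansion.sum fun i _ => ?_
    rw [← residue_eq, ← mul_assoc]
    exact (hr i).mul ((IsExpansion.X.pow _).pow _)

theorem completeHomogeneous_X_pow (e : ι → ℕ) (n : ℕ) :
    completeHomogeneous (fun i => (PowerSeries.X : PowerSeries ℂ) ^ e i) n =
      ∑ m ∈ finsuppAntidiag univ n, PowerSeries.X ^ ∑ i, m i * e i := by
  refine sum_congr rfl fun m _ => ?_
  rw [← prod_pow_eq_pow_sum]
  exact prod_congr rfl fun i _ => by rw [← pow_mul, mul_comm]

/-- The number of exponents `m` of degree `n` with `∑ i, m i * e i = n * D`, minus the number of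
those with `∑ i, m i * e i = n * D - 2`, is the coefficient of `z ^ (n * D)` in the sum of the
`r i * z ^ (n * e i)`. A term with `e i > D` contributes nothing: for `n > 0`
because a power series has no negative powers, for `n = 0` because `r i` vanishes at `0`. -/
theorem card_filter_sub_card_filter {e : ι → ℕ} (he : Function.Injective e)
    (he0 : ∃ i, e i = 0) {r : ι → PowerSeries ℂ}
    (hr : ∀ i, IsExpansion ((1 - RatFunc.X ^ 2) * residue e i) (r i)) (n D : ℕ) :
    (((finsuppAntidiag univ n).filter fun m : ι →₀ ℕ => ∑ i, m i * e i = n * D).card : ℂ) -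
      ((finsuppAntidiag univ n).filter fun m : ι →₀ ℕ => ∑ i, m i * e i + 2 = n * D).card =
      ∑ i, if e i ≤ D then PowerSeries.coeff (n * (D - e i)) (r i) else 0 := by
  obtain ⟨i₀, hi₀⟩ := he0
  have : Nonempty ι := ⟨i₀⟩
  have h := congrArg (PowerSeries.coeff (n * D)) (mul_completeHomogeneous_X_pow he hr n)
  rw [sub_mul, one_mul, completeHomogeneous_X_pow, mul_sum, map_sub, map_sum, map_sum,
    map_sum] at h
  simp only [← pow_add, PowerSeries.coeff_X_pow, sum_boole] at h
  refine Eq.trans ?_ (h.trans (sum_congr rfl fun i _ => ?_))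
  · simp only [eq_comm (a := n * D), add_comm 2]
  · rw [← pow_mul, PowerSeries.coeff_mul_X_pow']
    by_cases hi : e i ≤ D
    · rw [if_pos hi, if_pos (by rw [mul_comm]; exact Nat.mul_le_mul_left n hi), mul_comm (e i),
        Nat.mul_sub]
    · rw [if_neg hi]
      rcases Nat.eq_zero_or_pos n with rfl | hn
      · obtain ⟨s, hs, hs0⟩ := exists_isExpansion_residue he i
        rw [(hr i).unique ((IsExpansion.one.sub (IsExpansion.X.pow 2)).mul hs)]
        simp [hs0 ⟨i₀, by omega⟩]
      · rw [if_neg]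
        rw [mul_comm, not_le]
        exact Nat.mul_lt_mul_of_pos_left (not_le.mp hi) hn

theorem one_div_prod_eq_sum_div {L : Type*} [Field L] {R y : ι → L} (hy : ∀ i, y i ≠ 0)
    (h : ∑ i, R i * ∏ j ∈ univ.erase i, y j = 1) : 1 / ∏ i, y i = ∑ i, R i / y i := by
  rw [div_eq_iff (prod_ne_zero_iff.mpr fun i _ => hy i), sum_mul]
  refine h.symm.trans (sum_congr rfl fun i _ => ?_)
  rw [← mul_prod_erase univ _ (mem_univ i), ← mul_assoc, div_mul_cancel₀ _ (hy i)]

/-- The partial fraction decomposition of `1 / ∏ i, (1 - t z ^ e i)` in `ℂ(z)(t)`. -/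
theorem one_div_prod_eq_sum_residue [Nonempty ι] {e : ι → ℕ} (he : Function.Injective e) :
    1 / ∏ i, (1 - RatFunc.X * RatFunc.C (RatFunc.X ^ e i : RatFunc ℂ)) =
      ∑ i, RatFunc.C (residue e i) / (1 - RatFunc.X * RatFunc.C (RatFunc.X ^ e i : RatFunc ℂ)) := by
  have h := congrArg (algebraMap (Polynomial (RatFunc ℂ)) (RatFunc (RatFunc ℂ)))
    (sum_C_prod_mul_prod_one_sub_eq_one (x := fun i => (RatFunc.X ^ e i : RatFunc ℂ))
      (X_pow_injective.comp he) (fun i => pow_ne_zero _ (RatFunc.X_ne_zero (K := ℂ))))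
  simp only [← residue_eq, map_sum, map_mul, map_prod, map_sub, map_one, RatFunc.algebraMap_C,
    RatFunc.algebraMap_X] at h
  have hne : ∀ i, (1 - RatFunc.X * RatFunc.C (RatFunc.X ^ e i : RatFunc ℂ)) ≠ 0 := by
    intro i hi
    have h2 : (1 - Polynomial.X * Polynomial.C (RatFunc.X ^ e i : RatFunc ℂ)) = 0 := by
      apply RatFunc.algebraMap_injective (RatFunc ℂ)
      simpa using hi
    simpa using congrArg (Polynomial.eval 0) h2
  refine one_div_prod_eq_sum_div (L := RatFunc (RatFunc ℂ)) hne (Eq.trans ?_ h)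
  simp only [mul_comm RatFunc.X]

end Expansion

end BinaryForms

/-! ### The coefficients of the partial fraction decomposition -/

namespace BinaryForms

open Finset

/-- A product over the indices other than `k`, split into those below and those above `k`. -/
theorem prod_erase_fin {M : Type*} [CommMonoid M] {n k : ℕ} (hk : k < n + 1) (g : ℕ → M) :
    ∏ i ∈ (univ : Finset (Fin (n + 1))).erase ⟨k, hk⟩, g i =
      (∏ i ∈ range k, g i) * ∏ i ∈ range (n - k), g (k + 1 + i) := by
  have h1 : ∏ i ∈ (univ : Finset (Fin (n + 1))).erase ⟨k, hk⟩, g i =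
      ∏ i : Fin (n + 1), if (i : ℕ) = k then 1 else g i := by
    rw [← mul_prod_erase univ _ (mem_univ (⟨k, hk⟩ : Fin (n + 1))), if_pos rfl, one_mul]
    exact prod_congr rfl fun i hi => (if_neg fun h => (mem_erase.mp hi).1 (Fin.ext h)).symm
  rw [h1, Fin.prod_univ_eq_prod_range (fun i => if i = k then 1 else g i),
    show n + 1 = k + 1 + (n - k) by omega, prod_range_add, prod_range_succ, if_pos rfl, mul_one]
  congr 1
  · exact prod_congr rfl fun i hi => if_neg (mem_range.mp hi).ne
  · exact prod_congr rfl fun i _ => if_neg (by omega)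

theorem prod_erase_inl {M α β : Type*} [CommMonoid M] [Fintype α] [Fintype β] [DecidableEq α]
    [DecidableEq β] (f : α ⊕ β → M) (a : α) :
    ∏ j ∈ univ.erase (Sum.inl a), f j = (∏ i ∈ univ.erase a, f (Sum.inl i)) * ∏ i, f (Sum.inr i) := by
  rw [← prod_disjSum]
  refine prod_congr ?_ fun _ _ => rfl
  ext (i | i) <;> simp

theorem prod_erase_inr {M α β : Type*} [CommMonoid M] [Fintype α] [Fintype β] [DecidableEq α]
    [DecidableEq β] (f : α ⊕ β → M) (b : β) :
    ∏ j ∈ univ.erase (Sum.inr b), f j = (∏ i, f (Sum.inl i)) * ∏ i ∈ univ.erase b, f (Sum.inr i) := by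
  rw [← prod_disjSum]
  refine prod_congr ?_ fun _ _ => rfl
  ext (i | i) <;> simp

section QPochhammer

variable {K : Type*} [Field K] {x : K}

theorem qPoch_zpow (hx : x ≠ 0) (a : ℤ) (n : ℕ) :
    qPoch (x ^ a) (x ^ 2) n = ∏ i ∈ range n, (1 - x ^ (a + 2 * i)) := by
  refine prod_congr rfl fun i _ => ?_
  rw [zpow_add₀ hx, ← pow_mul]
  norm_cast

/-- `qPoch_zpow` with the factors in the opposite order. -/
theorem qPoch_zpow_reflect (hx : x ≠ 0) (a : ℤ) (n : ℕ) :
    qPoch (x ^ a) (x ^ 2) n = ∏ i ∈ range n, (1 - x ^ (a + 2 * (n - 1 - i))) := by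
  rw [qPoch_zpow hx, ← prod_range_reflect]
  refine prod_congr rfl fun i hi => ?_
  have := mem_range.mp hi
  congr 3
  omega

/-- Replacing `x` by `x⁻¹` in a `q`-Pochhammer product changes it by a sign and a power of `x`;
the factors of a residue with negative exponents are rewritten in this way. -/
theorem prod_one_sub_zpow_neg (hx : x ≠ 0) (a : ℤ) (n : ℕ) :
    ∏ i ∈ range n, (1 - x ^ (-(a + 2 * i))) =
      (-1) ^ n * x ^ (-(n * (a + n - 1))) * qPoch (x ^ a) (x ^ 2) n := by
  rw [qPoch_zpow hx]
  induction n with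
  | zero => simp
  | succ n ih =>
    rw [prod_range_succ, ih, prod_range_succ]
    have h1 : (1 - x ^ (-(a + 2 * (n : ℤ)))) =
        -(x ^ (-(a + 2 * (n : ℤ))) * (1 - x ^ (a + 2 * (n : ℤ)))) := by
      rw [mul_sub, ← zpow_add₀ hx, neg_add_cancel, zpow_zero]
      ring
    have h2 : x ^ (-(((n + 1 : ℕ) : ℤ) * (a + (n + 1 : ℕ) - 1))) =
        x ^ (-((n : ℤ) * (a + n - 1))) * x ^ (-(a + 2 * (n : ℤ))) := by
      rw [← zpow_add₀ hx]
      congr 1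
      push_cast
      ring
    rw [h1, h2]
    ring

end QPochhammer

/-- The exponents of `z` in the factors `1 - t z ^ e` of the denominator of
`f (t z ^ d₂, z)`; the hypothesis `d₁ < d₂` makes the subtraction exact. -/
def shiftedWeight (d₁ d₂ : ℕ) : Fin (d₁ + 1) ⊕ Fin (d₂ + 1) → ℕ :=
  Sum.elim (fun i => d₂ + d₁ - 2 * i) (fun i => 2 * (d₂ - i))

variable {d₁ d₂ : ℕ}

theorem shiftedWeight_cast (hlt : d₁ < d₂) (i : Fin (d₁ + 1) ⊕ Fin (d₂ + 1)) :
    (shiftedWeight d₁ d₂ i : ℤ) = d₂ + torusWeight d₁ d₂ i := by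
  rcases i with i | i <;> have := i.2 <;> simp [shiftedWeight, torusWeight] <;> omega

theorem shiftedWeight_injective (hlt : d₁ < d₂) (hodd : Odd (d₂ - d₁)) :
    Function.Injective (shiftedWeight d₁ d₂) := by
  obtain ⟨c, hc⟩ := hodd
  rintro (i | i) (j | j) h <;> have hi := i.2 <;> have hj := j.2 <;>
    simp only [shiftedWeight, Sum.elim_inl, Sum.elim_inr] at h
  · exact congrArg _ (Fin.ext (by omega))
  · omega
  · omega
  · exact congrArg _ (Fin.ext (by omega))

/-- The coefficient at the pole `t = z ^ (-(d₂ + d₁ - 2 k))`. The factors from the second form have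
exponents opposite to those in `coeffA`; inverting them produces the power
`z ^ ((d₂ + 1) * (d₁ - 2 k))`. -/
theorem residue_inl (hlt : d₁ < d₂) (hodd : Odd (d₂ - d₁)) {k : ℕ} (hk : k < d₁ + 1) :
    residue (shiftedWeight d₁ d₂) (Sum.inl ⟨k, hk⟩) = coeffA d₁ d₂ k := by
  have hX : (RatFunc.X : RatFunc ℂ) ≠ 0 := RatFunc.X_ne_zero
  have h1 : ∏ i ∈ range k, (1 - (RatFunc.X : RatFunc ℂ) ^ (2 * (k : ℤ) - 2 * i)) =
      qPoch (RatFunc.X ^ 2) (RatFunc.X ^ 2) k := by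
    have h := qPoch_zpow_reflect hX 2 k
    rw [show (RatFunc.X : RatFunc ℂ) ^ (2 : ℤ) = RatFunc.X ^ 2 by norm_cast] at h
    rw [h]
    refine prod_congr rfl fun i _ => ?_
    congr 2
    ring
  have h2 : ∏ i ∈ range (d₁ - k), (1 - (RatFunc.X : RatFunc ℂ) ^
      (2 * (k : ℤ) - 2 * ((k + 1 + i : ℕ) : ℤ))) =
      (-1) ^ (d₁ - k) * RatFunc.X ^ (-(((d₁ : ℤ) - k) * ((d₁ : ℤ) - k + 1))) *
        qPoch (RatFunc.X ^ 2) (RatFunc.X ^ 2) (d₁ - k) := by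
    have h := prod_one_sub_zpow_neg hX 2 (d₁ - k)
    rw [show (RatFunc.X : RatFunc ℂ) ^ (2 : ℤ) = RatFunc.X ^ 2 by norm_cast] at h
    rw [show (((d₁ : ℤ) - k) * ((d₁ : ℤ) - k + 1)) =
      ((d₁ - k : ℕ) : ℤ) * (2 + ((d₁ - k : ℕ) : ℤ) - 1) by
        rw [Nat.cast_sub (by omega)]; ring, ← h]
    refine prod_congr rfl fun i _ => ?_
    congr 2
    push_cast
    ring
  have h3 : ∏ i ∈ range (d₂ + 1), (1 - (RatFunc.X : RatFunc ℂ) ^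
      ((d₂ : ℤ) - d₁ + 2 * k - 2 * i)) =
      (-1) ^ (d₂ + 1) * RatFunc.X ^ (-(((d₂ : ℤ) + 1) * ((d₁ : ℤ) - 2 * k))) *
        qPoch (RatFunc.X ^ ((d₁ : ℤ) - d₂ - 2 * k)) (RatFunc.X ^ 2) (d₂ + 1) := by
    rw [show ((d₂ : ℤ) + 1) * ((d₁ : ℤ) - 2 * k) =
      ((d₂ + 1 : ℕ) : ℤ) * ((d₁ : ℤ) - d₂ - 2 * k + ((d₂ + 1 : ℕ) : ℤ) - 1) by
        push_cast; ring, ← prod_one_sub_zpow_neg hX]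
    refine prod_congr rfl fun i _ => ?_
    congr 2
    ring
  have hsign : ((-1 : RatFunc ℂ) ^ (d₁ - k) * (-1) ^ (d₂ + 1))⁻¹ = (-1) ^ k := by
    obtain ⟨c, hc⟩ := hodd
    rw [← pow_add, show d₁ - k + (d₂ + 1) = k + 2 * (c + 1 + (d₁ - k)) by omega, pow_add,
      pow_mul]
    rcases neg_one_pow_eq_or (RatFunc ℂ) k with h | h <;> rw [h] <;> norm_num
  have hprod : residue (shiftedWeight d₁ d₂) (Sum.inl ⟨k, hk⟩) =
      ((∏ i ∈ range k, (1 - (RatFunc.X : RatFunc ℂ) ^ (2 * (k : ℤ) - 2 * i))) *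
      (∏ i ∈ range (d₁ - k), (1 - (RatFunc.X : RatFunc ℂ) ^
        (2 * (k : ℤ) - 2 * ((k + 1 + i : ℕ) : ℤ)))) *
      ∏ i ∈ range (d₂ + 1), (1 - (RatFunc.X : RatFunc ℂ) ^
        ((d₂ : ℤ) - d₁ + 2 * k - 2 * i)))⁻¹ := by
    rw [residue, prod_inv_distrib]
    congr 1
    simp only [shiftedWeight_cast hlt]
    rw [prod_erase_inl,
      ← prod_erase_fin hk (fun i => (1 - (RatFunc.X : RatFunc ℂ) ^ (2 * (k : ℤ) - 2 * (i : ℤ)))),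
      ← Fin.prod_univ_eq_prod_range
        (fun i => (1 - (RatFunc.X : RatFunc ℂ) ^ ((d₂ : ℤ) - d₁ + 2 * k - 2 * (i : ℤ))))]
    congr 1
    · refine prod_congr rfl fun i _ => ?_
      simp only [torusWeight, Sum.elim_inl]
      congr 2
      ring
    · refine prod_congr rfl fun i _ => ?_
      simp only [torusWeight, Sum.elim_inl, Sum.elim_inr]
      congr 2
      ring
  rw [hprod, h1, h2, h3, coeffA, ← hsign, zpow_add₀ hX, zpow_neg, zpow_neg, div_eq_mul_inv]
  simp only [mul_inv, inv_inv]
  ring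

/-- The coefficient at the pole `t = z ^ (-2 k)`, in the shape that `coeffB` has for
`2 k < d₂ - d₁`; it is valid for all `k ≤ d₂`. -/
theorem residue_inr (hlt : d₁ < d₂) {k : ℕ} (hk : k ≤ d₂) :
    residue (shiftedWeight d₁ d₂) (Sum.inr ⟨d₂ - k, by omega⟩) =
      (-1) ^ k * RatFunc.X ^ (k * (k + 1)) /
        (qPoch (RatFunc.X ^ ((d₂ : ℤ) - d₁ - 2 * k)) (RatFunc.X ^ 2) (d₁ + 1) *
          qPoch (RatFunc.X ^ 2) (RatFunc.X ^ 2) k *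
          qPoch (RatFunc.X ^ 2) (RatFunc.X ^ 2) (d₂ - k)) := by
  have hX : (RatFunc.X : RatFunc ℂ) ≠ 0 := RatFunc.X_ne_zero
  have h1 : ∏ i ∈ range (d₂ - k), (1 - (RatFunc.X : RatFunc ℂ) ^
      (2 * (d₂ : ℤ) - 2 * k - 2 * i)) = qPoch (RatFunc.X ^ 2) (RatFunc.X ^ 2) (d₂ - k) := by
    have h := qPoch_zpow_reflect hX 2 (d₂ - k)
    rw [show (RatFunc.X : RatFunc ℂ) ^ (2 : ℤ) = RatFunc.X ^ 2 by norm_cast] at h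
    rw [h]
    refine prod_congr rfl fun i _ => ?_
    congr 2
    rw [Nat.cast_sub hk]
    ring
  have h2 : ∏ i ∈ range (d₂ - (d₂ - k)), (1 - (RatFunc.X : RatFunc ℂ) ^
      (2 * (d₂ : ℤ) - 2 * k - 2 * ((d₂ - k + 1 + i : ℕ) : ℤ))) =
      (-1) ^ k * (RatFunc.X ^ (k * (k + 1)))⁻¹ *
        qPoch (RatFunc.X ^ 2) (RatFunc.X ^ 2) k := by
    have h := prod_one_sub_zpow_neg hX 2 k
    rw [show (RatFunc.X : RatFunc ℂ) ^ (2 : ℤ) = RatFunc.X ^ 2 by norm_cast,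
      show (k : ℤ) * (2 + k - 1) = (k * (k + 1) : ℕ) by push_cast; ring, zpow_neg,
      zpow_natCast] at h
    rw [← h, show d₂ - (d₂ - k) = k by omega]
    refine prod_congr rfl fun i _ => ?_
    congr 2
    push_cast [Nat.cast_sub hk]
    ring
  have h3 : ∏ i ∈ range (d₁ + 1), (1 - (RatFunc.X : RatFunc ℂ) ^
      ((d₂ : ℤ) + d₁ - 2 * k - 2 * i)) =
      qPoch (RatFunc.X ^ ((d₂ : ℤ) - d₁ - 2 * k)) (RatFunc.X ^ 2) (d₁ + 1) := by
    rw [qPoch_zpow_reflect hX]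
    refine prod_congr rfl fun i _ => ?_
    congr 2
    push_cast
    ring
  have hprod : residue (shiftedWeight d₁ d₂) (Sum.inr ⟨d₂ - k, by omega⟩) =
      ((∏ i ∈ range (d₁ + 1), (1 - (RatFunc.X : RatFunc ℂ) ^
        ((d₂ : ℤ) + d₁ - 2 * k - 2 * i))) *
      ((∏ i ∈ range (d₂ - k), (1 - (RatFunc.X : RatFunc ℂ) ^ (2 * (d₂ : ℤ) - 2 * k - 2 * i))) *
      (∏ i ∈ range (d₂ - (d₂ - k)), (1 - (RatFunc.X : RatFunc ℂ) ^
        (2 * (d₂ : ℤ) - 2 * k - 2 * ((d₂ - k + 1 + i : ℕ) : ℤ))))))⁻¹ := by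
    rw [residue, prod_inv_distrib]
    congr 1
    simp only [shiftedWeight_cast hlt]
    rw [prod_erase_inr,
      ← prod_erase_fin (by omega) (fun i => (1 - (RatFunc.X : RatFunc ℂ) ^
        (2 * (d₂ : ℤ) - 2 * k - 2 * (i : ℤ)))),
      ← Fin.prod_univ_eq_prod_range
        (fun i => (1 - (RatFunc.X : RatFunc ℂ) ^ ((d₂ : ℤ) + d₁ - 2 * k - 2 * (i : ℤ))))]
    congr 1
    · refine prod_congr rfl fun i _ => ?_
      simp only [torusWeight, Sum.elim_inl, Sum.elim_inr]
      congr 2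
      rw [Nat.cast_sub hk]
      ring
    · refine prod_congr rfl fun i _ => ?_
      simp only [torusWeight, Sum.elim_inr]
      congr 2
      rw [Nat.cast_sub hk]
      ring
  have hsign : ((-1 : RatFunc ℂ) ^ k)⁻¹ = (-1) ^ k := by
    rcases neg_one_pow_eq_or (RatFunc ℂ) k with h | h <;> rw [h] <;> norm_num
  rw [hprod, h1, h2, h3, div_eq_mul_inv]
  nth_rw 2 [← hsign]
  simp only [mul_inv, inv_inv]
  ring

/-- Both cases of `coeffB` are given by the formula of the first one. -/
theorem coeffB_eq (hlt : d₁ < d₂) (hodd : Odd (d₂ - d₁)) {k : ℕ} (hk : 2 * k ≤ d₂) :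
    coeffB d₁ d₂ k =
      (-1) ^ k * RatFunc.X ^ (k * (k + 1)) /
        (qPoch (RatFunc.X ^ ((d₂ : ℤ) - d₁ - 2 * k)) (RatFunc.X ^ 2) (d₁ + 1) *
          qPoch (RatFunc.X ^ 2) (RatFunc.X ^ 2) k *
          qPoch (RatFunc.X ^ 2) (RatFunc.X ^ 2) (d₂ - k)) := by
  have hX : (RatFunc.X : RatFunc ℂ) ≠ 0 := RatFunc.X_ne_zero
  rw [coeffB]
  split_ifs with h
  · rfl
  obtain ⟨c, hc⟩ := hodd
  obtain ⟨s, hs⟩ : ∃ s, 2 * k = d₂ - d₁ + 2 * s + 1 := ⟨k - c - 1, by omega⟩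
  have hs2 : (2 * k - (d₂ - d₁) - 1) / 2 = s := by omega
  -- the first `s + 1` of the `d₁ + 1` factors have the negative exponents `-(2 s + 1), …, -1`
  have hq : qPoch ((RatFunc.X : RatFunc ℂ) ^ ((d₂ : ℤ) - d₁ - 2 * k)) (RatFunc.X ^ 2) (d₁ + 1) =
      (-1) ^ (s + 1) * (RatFunc.X ^ ((s + 1) ^ 2))⁻¹ * qPoch RatFunc.X (RatFunc.X ^ 2) (s + 1) *
        qPoch RatFunc.X (RatFunc.X ^ 2) (d₁ - s) := by
    have h1 := prod_one_sub_zpow_neg hX 1 (s + 1)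
    have h2 := qPoch_zpow hX 1 (d₁ - s)
    rw [zpow_one] at h1 h2
    rw [show ((s + 1 : ℕ) : ℤ) * (1 + (s + 1 : ℕ) - 1) = ((s + 1) ^ 2 : ℕ) by push_cast; ring,
      zpow_neg, zpow_natCast] at h1
    rw [← h1, h2, qPoch_zpow hX, show d₁ + 1 = s + 1 + (d₁ - s) by omega, prod_range_add,
      ← prod_range_reflect]
    congr 1
    · refine prod_congr rfl fun i hi => ?_
      have := mem_range.mp hi
      congr 2
      omega
    · refine prod_congr rfl fun i _ => ?_
      congr 2
      omega
  have hsign : (-1 : RatFunc ℂ) ^ ((d₂ - d₁ - 1) / 2) = (-1) ^ k * ((-1) ^ (s + 1))⁻¹ := by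
    rw [show k = (d₂ - d₁ - 1) / 2 + (s + 1) by omega, pow_add, mul_assoc, mul_inv_cancel₀, mul_one]
    exact pow_ne_zero _ (neg_ne_zero.mpr one_ne_zero)
  simp only [hs2]
  rw [hq, hsign, pow_add, div_eq_mul_inv, div_eq_mul_inv]
  simp only [mul_inv, inv_inv]
  ring

theorem residue_inr_eq_coeffB (hlt : d₁ < d₂) (hodd : Odd (d₂ - d₁)) {k : ℕ} (hk : 2 * k ≤ d₂) :
    residue (shiftedWeight d₁ d₂) (Sum.inr ⟨d₂ - k, by omega⟩) = coeffB d₁ d₂ k := by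
  rw [residue_inr hlt (by omega), coeffB_eq hlt hodd hk]

theorem mul_pow_mul_zpow {K : Type*} [Field K] {z : K} (hz : z ≠ 0) (t : K) (n : ℕ) (m : ℤ) :
    t * z ^ n * z ^ m = t * z ^ ((n : ℤ) + m) := by
  rw [zpow_add₀ hz, zpow_natCast, mul_assoc]

theorem isPartialFractionDecomposition_residue (hlt : d₁ < d₂) (hodd : Odd (d₂ - d₁)) :
    IsPartialFractionDecomposition d₁ d₂ (coeffA d₁ d₂)
      (fun k => residue (shiftedWeight d₁ d₂) (Sum.inr ⟨d₂ - k, by omega⟩)) := by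
  have hC : ∀ m : ℕ, RatFunc.C (RatFunc.X ^ m : RatFunc ℂ) =
      RatFunc.C (RatFunc.X : RatFunc ℂ) ^ (m : ℤ) :=
    fun m => by rw [map_pow, zpow_natCast]
  have hshift : ∀ m : ℤ, (RatFunc.X * RatFunc.C (RatFunc.X : RatFunc ℂ) ^ d₂) *
      RatFunc.C (RatFunc.X : RatFunc ℂ) ^ m =
        RatFunc.X * RatFunc.C (RatFunc.X : RatFunc ℂ) ^ ((d₂ : ℤ) + m) :=
    mul_pow_mul_zpow (K := RatFunc (RatFunc ℂ))
      ((map_ne_zero RatFunc.C).mpr RatFunc.X_ne_zero) _ d₂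
  have h := one_div_prod_eq_sum_residue (shiftedWeight_injective hlt hodd)
  rw [Fintype.prod_sum_type, Fintype.sum_sum_type] at h
  simp only [hC, shiftedWeight_cast hlt] at h
  simp only [torusWeight, Sum.elim_inl, Sum.elim_inr] at h
  simp only [IsPartialFractionDecomposition, genFun, hshift]
  rw [prod_range, prod_range]
  refine h.trans ?_
  congr 1
  · rw [sum_range]
    refine sum_congr rfl fun i _ => ?_
    rw [← residue_inl hlt hodd i.2, add_sub_assoc]
  · rw [← sum_range_reflect, sum_range]
    refine sum_congr rfl fun i _ => ?_
    have hi := i.2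
    have hfin : (⟨d₂ - (d₂ + 1 - 1 - (i : ℕ)), by omega⟩ : Fin (d₂ + 1)) = i :=
      Fin.ext (by simp only; omega)
    rw [hfin, show (d₂ : ℤ) + (d₂ - 2 * (i : ℕ)) = ((2 * (d₂ + 1 - 1 - (i : ℕ)) : ℕ) : ℤ) by omega]
    exact congrArg (fun w => RatFunc.C _ / (1 - RatFunc.X * w)) (zpow_natCast _ _)

/-! ### The Poincaré series -/

/-- Multiplying `t` by `z ^ d₂` shifts the weight of a monomial of degree `n` by `n * d₂`. -/
theorem weightMonomials_eq (hlt : d₁ < d₂) (n : ℕ) (w : ℤ) :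
    weightMonomials d₁ d₂ n w = (finsuppAntidiag univ n).filter
      fun m => ((∑ i, m i * shiftedWeight d₁ d₂ i : ℕ) : ℤ) = n * d₂ + w := by
  refine filter_congr fun m hm => ?_
  have hn : ∑ i, (m i : ℤ) = n := by exact_mod_cast (mem_finsuppAntidiag.mp hm).1
  have : ((∑ i, m i * shiftedWeight d₁ d₂ i : ℕ) : ℤ) =
      n * d₂ + ∑ i, (m i : ℤ) * torusWeight d₁ d₂ i := by
    push_cast
    simp only [shiftedWeight_cast hlt, mul_add, sum_add_distrib]
    rw [← sum_mul, hn]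
  rw [this, add_right_inj]

/-- By the Cayley–Sylvester formula the dimension is the coefficient of `t ^ n * z ^ (n * d₂)` in
`(1 - z ^ 2) * f (t z ^ d₂, z)`, which is read off the partial fraction decomposition. -/
theorem finrank_jointInvariantsOfDegree (hlt : d₁ < d₂) (hodd : Odd (d₂ - d₁))
    {r : Fin (d₁ + 1) ⊕ Fin (d₂ + 1) → PowerSeries ℂ}
    (hr : ∀ i, IsExpansion ((1 - RatFunc.X ^ 2) * residue (shiftedWeight d₁ d₂) i) (r i))
    (n : ℕ) :
    (Module.finrank ℂ (jointInvariantsOfDegree d₁ d₂ n) : ℂ) =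
      ∑ i, if shiftedWeight d₁ d₂ i ≤ d₂ then
        PowerSeries.coeff (n * (d₂ - shiftedWeight d₁ d₂ i)) (r i) else 0 := by
  rw [← card_filter_sub_card_filter (shiftedWeight_injective hlt hodd)
    ⟨Sum.inr (Fin.last d₂), by simp [shiftedWeight]⟩ hr n d₂, eq_sub_iff_add_eq]
  have h := finrank_jointInvariantsOfDegree_add (d₁ := d₁) (d₂ := d₂) n
  have h0 : weightMonomials d₁ d₂ n 0 = (finsuppAntidiag univ n).filter
      fun m => ∑ i, m i * shiftedWeight d₁ d₂ i = n * d₂ := by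
    rw [weightMonomials_eq hlt]
    refine filter_congr fun m _ => ?_
    rw [add_zero]
    norm_cast
  have h2 : weightMonomials d₁ d₂ n (-2) = (finsuppAntidiag univ n).filter
      fun m => ∑ i, m i * shiftedWeight d₁ d₂ i + 2 = n * d₂ := by
    rw [weightMonomials_eq hlt]
    refine filter_congr fun m _ => ?_
    rw [← sub_eq_add_neg, eq_sub_iff_add_eq]
    norm_cast
  rw [h0, h2] at h
  exact_mod_cast h

end BinaryForms

theorem theorem3 (d₁ d₂ : ℕ) (hlt : d₁ < d₂) (hodd : Odd (d₂ - d₁)) :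
    -- `A_k`, `B_k` come from the partial fraction decomposition of `f(t z^{d₂}, z)`
    (∃ B : ℕ → RatFunc ℂ,
      (∀ k : ℕ, 2 * k ≤ d₂ → B k = BinaryForms.coeffB d₁ d₂ k) ∧
      BinaryForms.IsPartialFractionDecomposition d₁ d₂ (BinaryForms.coeffA d₁ d₂) B) ∧
    -- `(1 - z²) A_k` and `(1 - z²) B_k` are power series, and the formula holds
    ∃ a b : ℕ → PowerSeries ℂ,
      (∀ k : ℕ, d₁ ≤ 2 * k → k ≤ d₁ →
        BinaryForms.IsExpansion ((1 - RatFunc.X ^ 2) * BinaryForms.coeffA d₁ d₂ k) (a k)) ∧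
      (∀ k : ℕ, 2 * k ≤ d₂ →
        BinaryForms.IsExpansion ((1 - RatFunc.X ^ 2) * BinaryForms.coeffB d₁ d₂ k) (b k)) ∧
      BinaryForms.poincareSeries d₁ d₂ =
        ∑ k ∈ (Finset.range (d₁ + 1)).filter (fun k => d₁ ≤ 2 * k),
            BinaryForms.phi (2 * k - d₁) (a k) +
          ∑ k ∈ Finset.range (d₂ / 2 + 1), BinaryForms.phi (d₂ - 2 * k) (b k) := by
  open BinaryForms in
  refine ⟨⟨_, fun k hk => residue_inr_eq_coeffB hlt hodd hk,
    isPartialFractionDecomposition_residue hlt hodd⟩, ?_⟩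
  have hex : ∀ i, ∃ r, IsExpansion ((1 - RatFunc.X ^ 2) *
      residue (shiftedWeight d₁ d₂) i) r := fun i => by
    obtain ⟨s, hs, -⟩ := exists_isExpansion_residue (shiftedWeight_injective hlt hodd) i
    exact ⟨_, (IsExpansion.one.sub (IsExpansion.X.pow 2)).mul hs⟩
  choose r hr using hex
  let a : ℕ → PowerSeries ℂ := fun k => if h : k < d₁ + 1 then r (Sum.inl ⟨k, h⟩) else 0
  let b : ℕ → PowerSeries ℂ := fun k => r (Sum.inr ⟨d₂ - k, by omega⟩)
  refine ⟨a, b, fun k _ hk => ?_, fun k hk => ?_, ?_⟩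
  · have h : k < d₁ + 1 := by omega
    rw [← residue_inl hlt hodd h]
    simp only [a, dif_pos h]
    exact hr (Sum.inl ⟨k, h⟩)
  · rw [← residue_inr_eq_coeffB hlt hodd hk]
    exact hr _
  · ext n
    rw [poincareSeries, PowerSeries.coeff_mk, finrank_jointInvariantsOfDegree hlt hodd hr,
      Fintype.sum_sum_type, map_add, map_sum, map_sum]
    simp only [phi, PowerSeries.coeff_mk]
    congr 1
    · rw [Finset.sum_filter, Finset.sum_range]
      refine Finset.sum_congr rfl fun i _ => ?_
      have hi := i.2
      simp only [shiftedWeight, Sum.elim_inl]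
      refine if_congr (by omega) ?_ rfl
      simp only [a, dif_pos hi]
      rw [show d₂ - (d₂ + d₁ - 2 * (i : ℕ)) = 2 * i - d₁ by omega]
    · have hfilter : Finset.range (d₂ / 2 + 1) =
          (Finset.range (d₂ + 1)).filter (fun k => 2 * k ≤ d₂) := by
        ext k
        simp only [Finset.mem_range, Finset.mem_filter]
        omega
      rw [hfilter, Finset.sum_filter, ← Finset.sum_range_reflect, Finset.sum_range]
      refine Finset.sum_congr rfl fun i _ => ?_
      have hi := i.2
      have hfin : (⟨d₂ - (d₂ + 1 - 1 - (i : ℕ)), by omega⟩ : Fin (d₂ + 1)) = i :=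
        Fin.ext (by simp only; omega)
      simp only [shiftedWeight, Sum.elim_inr, b, hfin]
      exact if_congr (by omega) (by rw [show d₂ + 1 - 1 - (i : ℕ) = d₂ - i by omega]) rfl
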